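/- Let \(g_1=(1,0)\), \(g_2=(1/2,\sqrt3/2)\), let \(\Lambda=\{mg_1+ng_2 : m,n\in\mathbb Z\}\subset\mathbb R^2\) be the triangular lattice, and let \(\Lambda_U\) be the undirected Cayley graph on \(\Lambda\) with generating set \[U=\{\pm g_1,\ \pm(g_1+g_2),\ \pm g_2,\ \pm(2g_2-g_1),\ \pm(g_2-g_1),\ \pm(g_2-2g_1)\}\] (so two lattice points are adjacent iff their distance is \(1\) or \(\sqrt3\)). For a finite non-empty \(S\subset\Lambda\), let \(\operatorname{hull}(S)\subset\Lambda\) be the set of lattice points in the intersection of the \(12\) supporting half-planes of \(S\) whose boundary lines are parallel to elements of \(U\), and let \(\mathscr P\) be the class of all induced subgraphs \(\Lambda_U[\operatorname{hull}(S)]\). The boundary of \(P\in\mathscr P\) is a convex polygon with \(12\) (possibly degenerate) sides, which we direct counterclockwise; in counterclockwise order, starting from direction \(g_1\), let \(u_1,t_1,u_2,t_2,\dots,u_6,t_6\) be the numbers of edges of \(\Lambda_U\) in the sides of \(P\) in the directions \(g_1,\ g_1+g_2,\ g_2,\ 2g_2-g_1,\ g_2-g_1,\ g_2-2g_1,\ -g_1,\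 -(g_1+g_2),\ -g_2,\ g_1-2g_2,\ g_1-g_2,\ 2g_1-g_2\), respectively, where an edge in a side joins two points of that side that differ by the stated direction vector. Theorem. Let \(P\in\mathscr P\) have \(n\ge 3\) vertices. Then \(P\) has at most \(\lfloor 6n-\sqrt{96n-63}\rfloor\) edges, unless there is a \(k\in\mathbb N\) with \(u_i=k\) and \(t_i=k-1\) for every \(i=1,\dots,6\), in which case \(P\) has at most \(6n-4\sqrt{6n-6}\) edges. -/

import Mathlib

namespace TriangularLattice

noncomputable section

/-- The Euclidean plane. -/
abbrev Plane : Type := EuclideanSpace ℝ (Fin 2)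

/-- The vector `(1, 0)`. -/
def e₁ : Plane := !₂[1, 0]

/-- The vector `(1/2, √3/2)`. -/
def e₂ : Plane := !₂[1 / 2, √3 / 2]

/-- The triangular lattice: all integer combinations `m • e₁ + n • e₂`. -/
def Lam : AddSubgroup Plane where
  carrier := {p | ∃ m n : ℤ, p = m • e₁ + n • e₂}
  zero_mem' := ⟨0, 0, by simp⟩
  add_mem' := by
    rintro _ _ ⟨m, n, rfl⟩ ⟨m', n', rfl⟩
    exact ⟨m + m', n + n', by rw [add_smul, add_smul]; abel⟩
  neg_mem' := by
    rintro _ ⟨m, n, rfl⟩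
    exact ⟨-m, -n, by rw [neg_smul, neg_smul]; abel⟩

/-- `e₁` as a lattice point. -/
def g₁ : Lam := ⟨e₁, 1, 0, by simp⟩

/-- `e₂` as a lattice point. -/
def g₂ : Lam := ⟨e₂, 0, 1, by simp⟩

/-- The six directions of length `1`, in counterclockwise order. -/
def shortDir : Fin 6 → Lam :=
  ![g₁, g₂, g₂ - g₁, -g₁, -g₂, g₁ - g₂]

/-- The six directions of length `√3`, in counterclockwise order; `longDir i` lies
between `shortDir i` and `shortDir (i + 1)`. -/
def longDir : Fin 6 → Lam :=
  ![g₁ + g₂, 2 • g₂ - g₁, g₂ - 2 • g₁, -(g₁ + g₂), g₁ - 2 • g₂, 2 • g₁ - g₂]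

/-- The symmetric generating set: all lattice vectors of length `1` or `√3`. -/
def U : Set Lam := Set.range shortDir ∪ Set.range longDir

/-- The undirected Cayley graph of the lattice with generating set `U`. -/
def LamU : SimpleGraph Lam := SimpleGraph.addCayley U

/-- The determinant of two plane vectors (positive if `y` is to the left of `x`). -/
def det (x y : Plane) : ℝ := x 0 * y 1 - x 1 * y 0

/-- The closed half-plane `{x | c ≤ det d x}`. Its boundary line is parallel to `d`,
and it lies to the left of that line when the line is directed by `d`. -/
def halfPlane (d : Plane) (c : ℝ) : Set Plane := {x | c ≤ det d x}

/-- The half-plane `halfPlane d c` supports `S`: it contains `S` and its boundary line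
meets `S`. -/
def IsSupporting (d : Plane) (c : ℝ) (S : Set Lam) : Prop :=
  (∀ s ∈ S, (s : Plane) ∈ halfPlane d c) ∧ ∃ s ∈ S, det d s = c

/-- The hull of `S`: the lattice points lying in all the supporting half-planes of `S`
parallel to an element of `U`. As `U = -U`, these are twelve half-planes, two for each of
the six lines spanned by elements of `U`. -/
def hull (S : Set Lam) : Set Lam :=
  {x | ∀ d ∈ U, ∀ c : ℝ, IsSupporting d c S → (x : Plane) ∈ halfPlane d c}

/-- The class of the subgraphs induced on hulls of finite (non-empty) sets. -/
def hullPolygons : Set LamU.Subgraph :=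
  {P | ∃ S : Set Lam, S.Finite ∧ S.Nonempty ∧
    P = (⊤ : LamU.Subgraph).induce (hull S)}

/-- The vertices of `P` on the side of `P` in direction `d`, the boundary of `P` being
directed counterclockwise: `P` lies to the left of this side. -/
def side (P : LamU.Subgraph) (d : Lam) : Set Lam :=
  {x | x ∈ P.verts ∧ ∀ y ∈ P.verts, det d x ≤ det d y}

/-- The number of edges `{x, x + d}` in the side of `P` in direction `d`. -/
def sideLength (P : LamU.Subgraph) (d : Lam) : ℕ :=
  {x : Lam | x ∈ side P d ∧ x + d ∈ side P d}.ncard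

/-- The parameters `u₁, …, u₆` of `P`. -/
def u (P : LamU.Subgraph) (i : Fin 6) : ℕ := sideLength P (shortDir i)

/-- The parameters `t₁, …, t₆` of `P`. -/
def t (P : LamU.Subgraph) (i : Fin 6) : ℕ := sideLength P (longDir i)

end

end TriangularLattice

/-!
In the coordinates `(p, q)` of `p • g₁ + q • g₂` every direction of `U` is, up to sign, one of six
vectors, and lines in these directions are the level sets of the six forms `p`, `q`, `p + q`,
`q - p`, `2p + q`, `p + 2q`. A hull is a finite set `F` which contains every lattice point whose six
values lie between values attained on `F` (`HullClosed`).

On each nonempty line some point of `F` has its successor outside `F`, so `F` has at most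
`6n - L` edges, `L` being the number of lines in the six directions that meet `F`
(`card_edgePairs_le`, `card_filter_add_card_image_form_le`). The theorem becomes the lower bound
`L² ≥ 96n - 63`, respectively `L² ≥ 96n - 96` for the exceptional polygons.

* If some line strictly between two supporting lines misses `F`, then `F` is thin or has a very
  acute corner. It then has a vertex which is the unique extremum of one of the forms and has degree
  at most `3` (`HullClosed.hasWeakVertex_of_gap`). Deleting it leaves a hull, and the bound follows
  by induction on `n`, starting at `n = 3`.
* If there is no such line, `L` is the sum of the six widths plus `6`. The set `F` arises from a big
  triangle by cutting off three corners, which leaves a hexagon with sides `sᵢ` in the short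
  directions, and then the six corners of this hexagon, of sizes `tᵢ`. The pieces cut off are
  disjoint lattice triangles, so `n` is at most a quadratic polynomial in the supporting numbers
  (`card_polygon_le`). With `σ = ∑ sᵢ` and `τ = ∑ tᵢ`, the difference `L² - (96n - 63)` is then at
  least `(σ - 3τ - 6)² - 33` plus a positive definite form in the differences of the `tᵢ` and of the
  `sᵢ`. Over the integers this is nonnegative, except where all `tᵢ` agree, all `sᵢ` agree and
  `σ - 3τ = 6` (`isoperimetric_aux`). These are the polygons with `uᵢ = k`, `tᵢ = k - 1`; for them
  the difference is still at least `-33`.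
-/

namespace TriangularLattice

open Finset

/-! ### Hulls in integer coordinates -/

/-- The six linear forms whose level sets are the lattice lines parallel to elements of `U`: the
forms with index `0, 1, 2` belong to the directions of length `1`, the others to those of length
`√3`. Up to sign, `form i` is the determinant with `dir i`. -/
def form : Fin 6 → ℤ × ℤ → ℤ :=
  ![fun z => z.1, fun z => z.2, fun z => z.1 + z.2,
    fun z => z.2 - z.1, fun z => 2 * z.1 + z.2, fun z => z.1 + 2 * z.2]

/-- The squared Euclidean length of `z.1 • g₁ + z.2 • g₂`; the elements of `U` are the lattice
vectors for which it is `1` or `3`. -/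
def normForm (z : ℤ × ℤ) : ℤ := z.1 ^ 2 + z.1 * z.2 + z.2 ^ 2

/-- `F` contains every point that none of the six forms separates strictly from `F`. No attained
extrema are mentioned, so this follows from the definition of `hull S` without computing the
supporting lines of `S`. -/
def HullClosed (F : Finset (ℤ × ℤ)) : Prop :=
  ∀ z, (∀ i, (∃ x ∈ F, form i x ≤ form i z) ∧ ∃ y ∈ F, form i z ≤ form i y) → z ∈ F

/-- The neighbours of `v` in the graph induced on `F`. -/
def nbrs (F : Finset (ℤ × ℤ)) (v : ℤ × ℤ) : Finset (ℤ × ℤ) :=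
  F.filter fun w => normForm (w - v) = 1 ∨ normForm (w - v) = 3

/-- Some vertex of degree at most `3` can be deleted from `F` so that a hull remains. -/
def HasWeakVertex (F : Finset (ℤ × ℤ)) : Prop :=
  ∃ v ∈ F, HullClosed (F.erase v) ∧ #(nbrs F v) ≤ 3

/-- The rotation by `60°`, in integer coordinates. -/
def rot (z : ℤ × ℤ) : ℤ × ℤ := (-z.2, z.1 + z.2)

lemma rot_injective : Function.Injective rot := by
  rintro ⟨a, b⟩ ⟨c, d⟩ h
  simp only [rot, Prod.mk.injEq] at h ⊢
  omega

lemma rot_surjective : Function.Surjective rot := by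
  rintro ⟨a, b⟩
  refine ⟨(a + b, -a), ?_⟩
  simp [rot]

lemma normForm_rot (z w : ℤ × ℤ) : normForm (rot z - rot w) = normForm (z - w) := by
  simp only [normForm, rot, Prod.fst_sub, Prod.snd_sub]
  ring

lemma eq_of_normForm {a b : ℤ} (h : normForm (a, b) = 1 ∨ normForm (a, b) = 3) :
    a = 1 ∧ b = 0 ∨ a = -1 ∧ b = 0 ∨ a = 0 ∧ b = 1 ∨ a = 0 ∧ b = -1 ∨
    a = 1 ∧ b = -1 ∨ a = -1 ∧ b = 1 ∨ a = 1 ∧ b = 1 ∨ a = -1 ∧ b = -1 ∨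
    a = -1 ∧ b = 2 ∨ a = 1 ∧ b = -2 ∨ a = -2 ∧ b = 1 ∨ a = 2 ∧ b = -1 := by
  simp only [normForm] at h
  have ha : 3 * a ^ 2 ≤ 12 := by rcases h with h | h <;> nlinarith [sq_nonneg (a + 2 * b)]
  have hb : 3 * b ^ 2 ≤ 12 := by rcases h with h | h <;> nlinarith [sq_nonneg (2 * a + b)]
  have ha1 : a ≤ 2 := by nlinarith
  have ha2 : -2 ≤ a := by nlinarith
  have hb1 : b ≤ 2 := by nlinarith
  have hb2 : -2 ≤ b := by nlinarith
  interval_cases a <;> interval_cases b <;> simp_all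

/-- A point outside `F` is separated strictly from `F` by one of the six forms. -/
lemma HullClosed.separation {F : Finset (ℤ × ℤ)} (hF : HullClosed F) {p q : ℤ}
    (hz : (p, q) ∉ F) :
    (∀ a b, (a, b) ∈ F → p < a) ∨ (∀ a b, (a, b) ∈ F → a < p) ∨
    (∀ a b, (a, b) ∈ F → q < b) ∨ (∀ a b, (a, b) ∈ F → b < q) ∨
    (∀ a b, (a, b) ∈ F → p + q < a + b) ∨ (∀ a b, (a, b) ∈ F → a + b < p + q) ∨
    (∀ a b, (a, b) ∈ F → q - p < b - a) ∨ (∀ a b, (a, b) ∈ F → b - a < q - p) ∨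
    (∀ a b, (a, b) ∈ F → 2 * p + q < 2 * a + b) ∨ (∀ a b, (a, b) ∈ F → 2 * a + b < 2 * p + q) ∨
    (∀ a b, (a, b) ∈ F → p + 2 * q < a + 2 * b) ∨ (∀ a b, (a, b) ∈ F → a + 2 * b < p + 2 * q) := by
  obtain ⟨i, h⟩ : ∃ i, (∀ x ∈ F, form i (p, q) < form i x) ∨
      ∀ y ∈ F, form i y < form i (p, q) := by
    by_contra! h
    exact hz (hF _ fun i => ⟨(h i).1, (h i).2⟩)
  simp only [Prod.forall] at h
  match i with
  | 0 | 1 | 2 | 3 | 4 | 5 =>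
    simp only [form, Matrix.cons_val] at h
    tauto

/-- Deleting the unique minimum or maximum of one of the forms leaves a hull. -/
lemma HullClosed.erase {F : Finset (ℤ × ℤ)} (hF : HullClosed F) {v : ℤ × ℤ} {i : Fin 6}
    (h : (∀ x ∈ F, x ≠ v → form i v < form i x) ∨ ∀ x ∈ F, x ≠ v → form i x < form i v) :
    HullClosed (F.erase v) := by
  intro z hz
  refine mem_erase.2 ⟨?_, hF z fun j => ?_⟩
  · rintro rfl
    obtain ⟨⟨x, hx, hxz⟩, y, hy, hyz⟩ := hz i
    rw [mem_erase] at hx hy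
    rcases h with h | h
    · exact absurd (h x hx.2 hx.1) (by omega)
    · exact absurd (h y hy.2 hy.1) (by omega)
  · obtain ⟨⟨x, hx, hxz⟩, y, hy, hyz⟩ := hz j
    exact ⟨⟨x, mem_of_mem_erase hx, hxz⟩, y, mem_of_mem_erase hy, hyz⟩

lemma HullClosed.image_rot {F : Finset (ℤ × ℤ)} (hF : HullClosed F) : HullClosed (F.image rot) := by
  intro z hz
  obtain ⟨w, rfl⟩ := rot_surjective z
  refine mem_image_of_mem _ (hF w fun i => ?_)
  simp only [exists_mem_image] at hz
  have h0 := hz 0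
  have h1 := hz 1
  have h2 := hz 2
  have h3 := hz 3
  have h4 := hz 4
  have h5 := hz 5
  simp only [form, rot, Matrix.cons_val] at h0 h1 h2 h3 h4 h5
  obtain ⟨⟨a0, ha0, ha0'⟩, b0, hb0, hb0'⟩ := h0
  obtain ⟨⟨a1, ha1, ha1'⟩, b1, hb1, hb1'⟩ := h1
  obtain ⟨⟨a2, ha2, ha2'⟩, b2, hb2, hb2'⟩ := h2
  obtain ⟨⟨a3, ha3, ha3'⟩, b3, hb3, hb3'⟩ := h3
  obtain ⟨⟨a4, ha4, ha4'⟩, b4, hb4, hb4'⟩ := h4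
  obtain ⟨⟨a5, ha5, ha5'⟩, b5, hb5, hb5'⟩ := h5
  fin_cases i
  · exact ⟨⟨a2, ha2, by simp [form]; omega⟩, b2, hb2, by simp [form]; omega⟩
  · exact ⟨⟨b0, hb0, by simp [form]; omega⟩, a0, ha0, by simp [form]; omega⟩
  · exact ⟨⟨a1, ha1, by simp [form]; omega⟩, b1, hb1, by simp [form]; omega⟩
  · exact ⟨⟨b4, hb4, by simp [form]; omega⟩, a4, ha4, by simp [form]; omega⟩
  · exact ⟨⟨a5, ha5, by simp [form]; omega⟩, b5, hb5, by simp [form]; omega⟩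
  · exact ⟨⟨a3, ha3, by simp [form]; omega⟩, b3, hb3, by simp [form]; omega⟩

lemma hullClosed_of_image_rot {F : Finset (ℤ × ℤ)} (hF : HullClosed (F.image rot)) :
    HullClosed F := by
  have key : ∀ G : Finset (ℤ × ℤ), ((((((G.image rot).image rot).image rot).image rot).image
      rot).image rot) = G := by
    intro G
    simp only [image_image]
    have : (((((rot ∘ rot) ∘ rot) ∘ rot) ∘ rot) ∘ rot) = id := by
      ext z <;> simp [rot]
    simp only [← Function.comp_assoc, this, image_id]
  rw [← key F]
  exact hF.image_rot.image_rot.image_rot.image_rot.image_rot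

lemma HasWeakVertex.of_image_rot {F : Finset (ℤ × ℤ)} (h : HasWeakVertex (F.image rot)) :
    HasWeakVertex F := by
  obtain ⟨v, hv, h1, h2⟩ := h
  obtain ⟨w, hw, rfl⟩ := mem_image.1 hv
  refine ⟨w, hw, hullClosed_of_image_rot ?_, ?_⟩
  · rwa [image_erase rot_injective]
  · have : nbrs (F.image rot) (rot w) = (nbrs F w).image rot := by
      simp only [nbrs, filter_image, normForm_rot]
    rwa [this, card_image_of_injective _ rot_injective] at h2

/-- A vertex is weak if it is the unique extremum of a form and all its neighbours in `F` are among
three given translates of it. The hypothesis `hd` lists the elements of `U` in coordinates, which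
makes it a statement of linear arithmetic. -/
lemma HullClosed.hasWeakVertex {F : Finset (ℤ × ℤ)} (hF : HullClosed F) {p q : ℤ}
    (hv : (p, q) ∈ F) (i : Fin 6)
    (h : (∀ a b, (a, b) ∈ F → a ≠ p ∨ b ≠ q → form i (p, q) < form i (a, b)) ∨
      ∀ a b, (a, b) ∈ F → a ≠ p ∨ b ≠ q → form i (a, b) < form i (p, q)) (d₁ d₂ d₃ : ℤ × ℤ)
    (hd : ∀ a b, (a, b) ∈ F →
      a - p = 1 ∧ b - q = 0 ∨ a - p = -1 ∧ b - q = 0 ∨ a - p = 0 ∧ b - q = 1 ∨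
      a - p = 0 ∧ b - q = -1 ∨ a - p = 1 ∧ b - q = -1 ∨ a - p = -1 ∧ b - q = 1 ∨
      a - p = 1 ∧ b - q = 1 ∨ a - p = -1 ∧ b - q = -1 ∨ a - p = -1 ∧ b - q = 2 ∨
      a - p = 1 ∧ b - q = -2 ∨ a - p = -2 ∧ b - q = 1 ∨ a - p = 2 ∧ b - q = -1 →
      (a = p + d₁.1 ∧ b = q + d₁.2) ∨ (a = p + d₂.1 ∧ b = q + d₂.2) ∨
        (a = p + d₃.1 ∧ b = q + d₃.2)) :
    HasWeakVertex F := by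
  refine ⟨(p, q), hv, hF.erase (i := i) ?_, ?_⟩
  · refine h.imp (fun h => ?_) fun h => ?_ <;>
    · rintro ⟨a, b⟩ hab hne
      refine h a b hab ?_
      by_contra! hc
      exact hne (by rw [hc.1, hc.2])
  · have hsub : nbrs F (p, q) ⊆ {(p, q) + d₁, (p, q) + d₂, (p, q) + d₃} := by
      rintro ⟨a, b⟩ hab
      obtain ⟨hab, hn⟩ := mem_filter.1 hab
      have := hd a b hab (eq_of_normForm hn)
      simpa [Prod.ext_iff] using this
    exact (card_le_card hsub).trans card_le_three

/-! ### Lines that miss a hull -/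

/-- A horizontal lattice line between two points of `F` can miss `F` only if `F` lies on a line of
direction `(-1, 2)`. If the real hull crosses `q = c` between the consecutive lattice points
`(k, c)` and `(k + 1, c)`, then of the six forms only `2p + q` can separate these points
from `F`. -/
lemma HullClosed.hasWeakVertex_of_gap_short {F : Finset (ℤ × ℤ)} (hF : HullClosed F) {c : ℤ}
    {x y : ℤ × ℤ} (hx : x ∈ F) (hy : y ∈ F) (hxc : x.2 < c) (hyc : c < y.2)
    (hc : ∀ z ∈ F, z.2 ≠ c) : HasWeakVertex F := by
  obtain ⟨x₁, x₂⟩ := x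
  obtain ⟨y₁, y₂⟩ := y
  obtain ⟨α, rfl⟩ : ∃ α, x₂ = c - α := ⟨c - x₂, by ring⟩
  obtain ⟨β, rfl⟩ : ∃ β, y₂ = c + β := ⟨y₂ - c, by ring⟩
  have hα : 0 < α := by simpa using hxc
  have hβ : 0 < β := by simpa using hyc
  -- `k` is the floor of the first coordinate of the point where the segment from `x` to `y`
  -- crosses the line.
  obtain ⟨k, hk₁, hk₂⟩ : ∃ k, (α + β) * k ≤ β * x₁ + α * y₁ ∧
      β * x₁ + α * y₁ < (α + β) * (k + 1) :=
    ⟨(β * x₁ + α * y₁) / (α + β), Int.mul_ediv_self_le (by omega),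
      (Int.lt_ediv_add_one_mul_self _ (by omega)).trans_eq (mul_comm _ _)⟩
  have hA : ∀ p q, (p, q) ∈ F → 2 * k + c < 2 * p + q := by
    rcases hF.separation (fun h => hc (k, c) h rfl) with
      h | h | h | h | h | h | h | h | h | h | h | h <;>
      first
      | exact h
      | exfalso
        have h₁ := mul_nonneg hβ.le (sub_nonneg.2 (Int.add_one_le_of_lt (h _ _ hx)))
        have h₂ := mul_nonneg hα.le (sub_nonneg.2 (Int.add_one_le_of_lt (h _ _ hy)))
        nlinarith
  have hk₃ : (α + β) * k < β * x₁ + α * y₁ := by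
    have h₁ := mul_nonneg hβ.le (sub_nonneg.2 (Int.add_one_le_of_lt (hA _ _ hx)))
    have h₂ := mul_nonneg hα.le (sub_nonneg.2 (Int.add_one_le_of_lt (hA _ _ hy)))
    nlinarith
  have hB : ∀ p q, (p, q) ∈ F → 2 * p + q < 2 * (k + 1) + c := by
    rcases hF.separation (fun h => hc (k + 1, c) h rfl) with
      h | h | h | h | h | h | h | h | h | h | h | h <;>
      first
      | exact h
      | exfalso
        have h₁ := mul_nonneg hβ.le (sub_nonneg.2 (Int.add_one_le_of_lt (h _ _ hx)))
        have h₂ := mul_nonneg hα.le (sub_nonneg.2 (Int.add_one_le_of_lt (h _ _ hy)))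
        nlinarith
  obtain ⟨⟨p, q⟩, hv, hmax⟩ := F.exists_max_image Prod.snd ⟨_, hx⟩
  refine hF.hasWeakVertex hv 1 (Or.inr fun a b hab hne => ?_) (1, -2) (1, -2) (1, -2)
    fun a b hab hd => ?_
  all_goals
    have h₁ := hA _ _ hv
    have h₂ := hB _ _ hv
    have h₃ := hA _ _ hab
    have h₄ := hB _ _ hab
    have h₅ := hmax _ hab
    simp only [form, Matrix.cons_val] at h₅ ⊢
    omega

/-- If a lattice line of direction `(1, 1)` between two points of `F` misses `F`, the real hull
crosses it between consecutive lattice points `(k, k + c)` and `(k + 1, k + 1 + c)`. Each of these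
is separated from `F` by one of `p + q`, `2p + q`, `p + 2q`, and the nine combinations leave either
a strip of at most two lattice lines or a corner of at most `60°`. -/
lemma HullClosed.hasWeakVertex_of_gap_long {F : Finset (ℤ × ℤ)} (hF : HullClosed F) {c : ℤ}
    {x y : ℤ × ℤ} (hx : x ∈ F) (hy : y ∈ F) (hxc : x.2 - x.1 < c) (hyc : c < y.2 - y.1)
    (hc : ∀ z ∈ F, z.2 - z.1 ≠ c) : HasWeakVertex F := by
  obtain ⟨x₁, x₂⟩ := x
  obtain ⟨y₁, y₂⟩ := y
  obtain ⟨α, rfl⟩ : ∃ α, x₂ = x₁ + c - α := ⟨x₁ + c - x₂, by ring⟩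
  obtain ⟨β, rfl⟩ : ∃ β, y₂ = y₁ + c + β := ⟨y₂ - y₁ - c, by ring⟩
  have hα : 0 < α := by simp only at hxc; omega
  have hβ : 0 < β := by simp only at hyc; omega
  -- `k` is the floor of the first coordinate of the point where the segment from `x` to `y`
  -- crosses the line.
  obtain ⟨k, hk₁, hk₂⟩ : ∃ k, (α + β) * k ≤ β * x₁ + α * y₁ ∧
      β * x₁ + α * y₁ < (α + β) * (k + 1) :=
    ⟨(β * x₁ + α * y₁) / (α + β), Int.mul_ediv_self_le (by omega),
      (Int.lt_ediv_add_one_mul_self _ (by omega)).trans_eq (mul_comm _ _)⟩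
  have hA : (∀ p q, (p, q) ∈ F → k + (k + c) < p + q) ∨
      (∀ p q, (p, q) ∈ F → 2 * k + (k + c) < 2 * p + q) ∨
      (∀ p q, (p, q) ∈ F → k + 2 * (k + c) < p + 2 * q) := by
    rcases hF.separation (fun h => hc (k, k + c) h (by simp)) with
      h | h | h | h | h | h | h | h | h | h | h | h <;>
      first
      | exact Or.inl h
      | exact Or.inr (Or.inl h)
      | exact Or.inr (Or.inr h)
      | exfalso
        have h₁ := mul_nonneg hβ.le (sub_nonneg.2 (Int.add_one_le_of_lt (h _ _ hx)))
        have h₂ := mul_nonneg hα.le (sub_nonneg.2 (Int.add_one_le_of_lt (h _ _ hy)))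
        nlinarith
  have hk₃ : (α + β) * k < β * x₁ + α * y₁ := by
    rcases hA with h | h | h <;>
    · have h₁ := mul_nonneg hβ.le (sub_nonneg.2 (Int.add_one_le_of_lt (h _ _ hx)))
      have h₂ := mul_nonneg hα.le (sub_nonneg.2 (Int.add_one_le_of_lt (h _ _ hy)))
      nlinarith
  have hB : (∀ p q, (p, q) ∈ F → p + q < k + 1 + (k + 1 + c)) ∨
      (∀ p q, (p, q) ∈ F → 2 * p + q < 2 * (k + 1) + (k + 1 + c)) ∨
      (∀ p q, (p, q) ∈ F → p + 2 * q < k + 1 + 2 * (k + 1 + c)) := by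
    rcases hF.separation (fun h => hc (k + 1, k + 1 + c) h (by simp)) with
      h | h | h | h | h | h | h | h | h | h | h | h <;>
      first
      | exact Or.inl h
      | exact Or.inr (Or.inl h)
      | exact Or.inr (Or.inr h)
      | exfalso
        have h₁ := mul_nonneg hβ.le (sub_nonneg.2 (Int.add_one_le_of_lt (h _ _ hx)))
        have h₂ := mul_nonneg hα.le (sub_nonneg.2 (Int.add_one_le_of_lt (h _ _ hy)))
        nlinarith
  have hlow : (x₁, x₁ + c - α) = (k + 1, k + c) → (k + 1, k + c) ∈ F := fun h => h ▸ hx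
  have hhigh : (y₁, y₁ + c + β) = (k, k + c + 1) → (k, k + c + 1) ∈ F := fun h => h ▸ hy
  rw [Prod.mk.injEq] at hlow hhigh
  obtain ⟨⟨p, q⟩, hv, hmax⟩ := F.exists_max_image Prod.fst ⟨_, hx⟩
  obtain ⟨⟨p', q'⟩, hv', hmax'⟩ := F.exists_max_image Prod.snd ⟨_, hx⟩
  rcases hA with hA | hA | hA <;> rcases hB with hB | hB | hB
  -- `F` lies on a line `p + q = const`: an end point of a segment is weak.
  · refine hF.hasWeakVertex hv 0 (Or.inr fun a b hab hne => ?_) (-1, 1) (-1, 1) (-1, 1)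
      fun a b hab hd => ?_
    all_goals
      have h₁ := hA _ _ hv
      have h₂ := hB _ _ hv
      have h₃ := hA _ _ hab
      have h₄ := hB _ _ hab
      have h₅ := hmax _ hab
      simp only [form, Matrix.cons_val] at h₅ ⊢
      omega
  -- Otherwise `F` lies in a corner whose apex is the unique extremum of `q - p` and has the value
  -- `c - 1` or `c + 1`, so a point of `F` on this side of the line can only be the apex.
  · have h₁ := hA _ _ hx
    have h₂ := hB _ _ hx
    refine hF.hasWeakVertex (hlow (by omega)) 3 (Or.inl fun a b hab hne => ?_)
      (-1, 1) (-1, 2) (-2, 1) fun a b hab hd => ?_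
    all_goals
      have h₃ := hA _ _ hab
      have h₄ := hB _ _ hab
      simp only [form, Matrix.cons_val]
      omega
  · have h₁ := hA _ _ hy
    have h₂ := hB _ _ hy
    refine hF.hasWeakVertex (hhigh (by omega)) 3 (Or.inr fun a b hab hne => ?_)
      (1, -1) (1, -2) (2, -1) fun a b hab hd => ?_
    all_goals
      have h₃ := hA _ _ hab
      have h₄ := hB _ _ hab
      simp only [form, Matrix.cons_val]
      omega
  · have h₁ := hA _ _ hy
    have h₂ := hB _ _ hy
    refine hF.hasWeakVertex (hhigh (by omega)) 3 (Or.inr fun a b hab hne => ?_)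
      (1, -1) (1, -2) (2, -1) fun a b hab hd => ?_
    all_goals
      have h₃ := hA _ _ hab
      have h₄ := hB _ _ hab
      simp only [form, Matrix.cons_val]
      omega
  -- `F` lies on two adjacent lines of direction `(-1, 2)`; the form `q` is injective there.
  · refine hF.hasWeakVertex hv' 1 (Or.inr fun a b hab hne => ?_) (1, -2) (1, -1) (0, -1)
      fun a b hab hd => ?_
    all_goals
      have h₁ := hA _ _ hv'
      have h₂ := hB _ _ hv'
      have h₃ := hA _ _ hab
      have h₄ := hB _ _ hab
      have h₅ := hmax' _ hab
      simp only [form, Matrix.cons_val] at h₅ ⊢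
      omega
  · have h₁ := hA _ _ hy
    have h₂ := hB _ _ hy
    refine hF.hasWeakVertex (hhigh (by omega)) 3 (Or.inr fun a b hab hne => ?_)
      (1, -1) (1, -2) (2, -1) fun a b hab hd => ?_
    all_goals
      have h₃ := hA _ _ hab
      have h₄ := hB _ _ hab
      simp only [form, Matrix.cons_val]
      omega
  · have h₁ := hA _ _ hx
    have h₂ := hB _ _ hx
    refine hF.hasWeakVertex (hlow (by omega)) 3 (Or.inl fun a b hab hne => ?_)
      (-1, 1) (-1, 2) (-2, 1) fun a b hab hd => ?_
    all_goals
      have h₃ := hA _ _ hab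
      have h₄ := hB _ _ hab
      simp only [form, Matrix.cons_val]
      omega
  · have h₁ := hA _ _ hx
    have h₂ := hB _ _ hx
    refine hF.hasWeakVertex (hlow (by omega)) 3 (Or.inl fun a b hab hne => ?_)
      (-1, 1) (-1, 2) (-2, 1) fun a b hab hd => ?_
    all_goals
      have h₃ := hA _ _ hab
      have h₄ := hB _ _ hab
      simp only [form, Matrix.cons_val]
      omega
  -- `F` lies on two adjacent lines of direction `(-2, 1)`; the form `p` is injective there.
  · refine hF.hasWeakVertex hv 0 (Or.inr fun a b hab hne => ?_) (-2, 1) (-1, 1) (-1, 0)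
      fun a b hab hd => ?_
    all_goals
      have h₁ := hA _ _ hv
      have h₂ := hB _ _ hv
      have h₃ := hA _ _ hab
      have h₄ := hB _ _ hab
      have h₅ := hmax _ hab
      simp only [form, Matrix.cons_val] at h₅ ⊢
      omega

/-- If a lattice line parallel to an element of `U` has points of `F` on both sides but contains no
point of `F`, then `F` has a weak vertex. The rotation by `60°` reduces this to one short and one
long direction. -/
lemma HullClosed.hasWeakVertex_of_gap {F : Finset (ℤ × ℤ)} (hF : HullClosed F) (i : Fin 6) {c : ℤ}
    {x y : ℤ × ℤ} (hx : x ∈ F) (hy : y ∈ F) (hxc : form i x < c) (hyc : c < form i y)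
    (hc : ∀ z ∈ F, form i z ≠ c) : HasWeakVertex F := by
  have hx' := mem_image_of_mem rot hx
  have hy' := mem_image_of_mem rot hy
  match i with
  | 0 =>
    refine .of_image_rot (.of_image_rot (hF.image_rot.image_rot.hasWeakVertex_of_gap_short (c := c)
      (mem_image_of_mem rot hx') (mem_image_of_mem rot hy') ?_ ?_ ?_))
    · simpa [rot, form] using hxc
    · simpa [rot, form] using hyc
    · simpa only [forall_mem_image, rot, form, Matrix.cons_val, add_comm, neg_add_cancel_right,
        add_neg_cancel_right, neg_add_cancel_comm] using hc
  | 1 => exact hF.hasWeakVertex_of_gap_short hx hy hxc hyc hc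
  | 2 =>
    refine .of_image_rot (hF.image_rot.hasWeakVertex_of_gap_short (c := c)
      hx' hy' ?_ ?_ ?_)
    · simpa [rot, form] using hxc
    · simpa [rot, form] using hyc
    · simpa only [forall_mem_image, rot, form, Matrix.cons_val] using hc
  | 3 => exact hF.hasWeakVertex_of_gap_long hx hy hxc hyc hc
  | 4 =>
    refine .of_image_rot (.of_image_rot (hF.image_rot.image_rot.hasWeakVertex_of_gap_long (c := c)
      (mem_image_of_mem rot hx') (mem_image_of_mem rot hy') ?_ ?_ ?_))
    · simp only [rot, form, Matrix.cons_val] at *; omega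
    · simp only [rot, form, Matrix.cons_val] at *; omega
    · simp only [forall_mem_image, rot]
      intro z hz
      have := hc z hz
      simp only [form, Matrix.cons_val] at this
      omega
  | 5 =>
    refine .of_image_rot (hF.image_rot.hasWeakVertex_of_gap_long (c := c)
      hx' hy' ?_ ?_ ?_)
    · simp only [rot, form, Matrix.cons_val] at *; omega
    · simp only [rot, form, Matrix.cons_val] at *; omega
    · simp only [forall_mem_image, rot]
      intro z hz
      have := hc z hz
      simp only [form, Matrix.cons_val] at this
      omega

/-! ### Edges and lines -/

/-- One direction out of each of the six pairs `± d` in `U`; `form i` is constant along `dir i`. -/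
def dir : Fin 6 → ℤ × ℤ :=
  ![(0, 1), (1, 0), (-1, 1), (1, 1), (-1, 2), (-2, 1)]

/-- The edges of the graph induced on `F`, each listed once as the ordered pair `(x, x + dir i)`. -/
def edgePairs (F : Finset (ℤ × ℤ)) : Finset ((ℤ × ℤ) × (ℤ × ℤ)) :=
  (F ×ˢ F).filter fun e => ∃ i, e.2 - e.1 = dir i

lemma form_add_dir (i : Fin 6) (z : ℤ × ℤ) : form i (z + dir i) = form i z := by
  fin_cases i <;> simp [form, dir] <;> ring

lemma card_edgePairs_le (F : Finset (ℤ × ℤ)) :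
    #(edgePairs F) ≤ ∑ i, #(F.filter fun x => x + dir i ∈ F) := by
  have hsub : edgePairs F ⊆ univ.biUnion fun i =>
      (F.filter fun x => x + dir i ∈ F).image fun x => (x, x + dir i) := by
    rintro ⟨x, y⟩ h
    simp only [edgePairs, mem_filter, mem_product] at h
    obtain ⟨⟨hx, hy⟩, i, hi⟩ := h
    obtain rfl : y = x + dir i := by rw [← hi]; abel
    simp only [mem_biUnion, mem_univ, true_and]
    exact ⟨i, mem_image.2 ⟨x, mem_filter.2 ⟨hx, hy⟩, rfl⟩⟩
  exact (card_le_card hsub).trans (card_biUnion_le.trans (sum_le_sum fun i _ => card_image_le))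

/-- The number of edges in direction `dir i` is at most the number of points minus the number of
nonempty lines in this direction: the last point of `F` on each line starts no edge. -/
lemma card_filter_add_card_image_form_le (F : Finset (ℤ × ℤ)) (i : Fin 6) :
    #(F.filter fun x => x + dir i ∈ F) + #(F.image (form i)) ≤ #F := by
  rw [← card_filter_add_card_filter_not (s := F) (fun x => x + dir i ∈ F)]
  refine Nat.add_le_add_left ?_ _
  refine (card_le_card ?_).trans (card_image_le (f := form i))
  intro c hc
  obtain ⟨x, hx, rfl⟩ := mem_image.1 hc
  obtain ⟨y, hy, hmax⟩ := (F.filter fun y => form i y = form i x).exists_max_image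
    (fun z => z.1 * (dir i).1 + z.2 * (dir i).2) ⟨x, by simp [hx]⟩
  rw [mem_filter] at hy
  refine mem_image.2 ⟨y, mem_filter.2 ⟨hy.1, fun h => ?_⟩, hy.2⟩
  have h₁ := hmax (y + dir i) (mem_filter.2 ⟨h, by rw [form_add_dir, hy.2]⟩)
  have h₂ : 0 < (dir i).1 * (dir i).1 + (dir i).2 * (dir i).2 := by
    fin_cases i <;> simp [dir]
  simp only [Prod.fst_add, Prod.snd_add] at h₁
  linarith

/-- Without a weak vertex, `form i` takes on `F` all integer values between any two of its
values. -/
lemma HullClosed.width_le {F : Finset (ℤ × ℤ)} (hF : HullClosed F) (hw : ¬ HasWeakVertex F)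
    (i : Fin 6) {x y : ℤ × ℤ} (hx : x ∈ F) (hy : y ∈ F) :
    form i y - form i x + 1 ≤ #(F.image (form i)) := by
  have hsub : Icc (form i x) (form i y) ⊆ F.image (form i) := by
    intro c hc
    by_contra hcn
    have hcn' : ∀ z ∈ F, form i z ≠ c := fun z hz h => hcn (mem_image.2 ⟨z, hz, h⟩)
    rw [mem_Icc] at hc
    exact hw (hF.hasWeakVertex_of_gap i hx hy (lt_of_le_of_ne hc.1 (hcn' x hx))
      (lt_of_le_of_ne hc.2 (hcn' y hy).symm) hcn')
  have := card_le_card hsub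
  rw [Int.card_Icc] at this
  omega

lemma card_edgePairs_le_erase (F : Finset (ℤ × ℤ)) (v : ℤ × ℤ) :
    #(edgePairs F) ≤ #(edgePairs (F.erase v)) + #(nbrs F v) := by
  have hn : ∀ i, normForm (dir i) = 1 ∨ normForm (dir i) = 3 := by
    intro i
    fin_cases i <;> simp [dir, normForm]
  have hn' : ∀ z, normForm (-z) = normForm z := fun z => by simp [normForm]
  have hdd : ∀ i j, dir i ≠ -dir j := by decide
  have hsub : edgePairs F ⊆ edgePairs (F.erase v) ∪
      (nbrs F v).image fun w => if ∃ i, w - v = dir i then (v, w) else (w, v) := by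
    rintro ⟨x, y⟩ h
    simp only [edgePairs, mem_filter, mem_product] at h
    obtain ⟨⟨hx, hy⟩, i, hi⟩ := h
    rw [mem_union]
    by_cases hxv : x = v
    · subst hxv
      refine Or.inr (mem_image.2 ⟨y, mem_filter.2 ⟨hy, hi ▸ hn i⟩, if_pos ⟨i, hi⟩⟩)
    by_cases hyv : y = v
    · subst hyv
      have hi' : x - y = -dir i := by rw [← hi]; abel
      refine Or.inr (mem_image.2 ⟨x, mem_filter.2 ⟨hx, ?_⟩, if_neg ?_⟩)
      · rw [hi', hn']
        exact hn i
      · rintro ⟨j, hj⟩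
        exact hdd j i (hj.symm.trans hi')
    · refine Or.inl (mem_filter.2 ⟨?_, i, hi⟩)
      simp [hx, hy, hxv, hyv]
  exact (card_le_card hsub).trans ((card_union_le _ _).trans
    (Nat.add_le_add_left card_image_le _))

lemma two_mul_card_edgePairs_le (F : Finset (ℤ × ℤ)) :
    2 * #(edgePairs F) ≤ #F * #F - #F := by
  have hd : ∀ i, dir i ≠ 0 := by
    intro i
    fin_cases i <;> simp [dir]
  have hdd : ∀ i j, dir i ≠ -dir j := by decide
  have hdisj : Disjoint (edgePairs F) ((edgePairs F).image Prod.swap) := by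
    rw [Finset.disjoint_left]
    rintro ⟨x, y⟩ h₁ h₂
    obtain ⟨⟨a, b⟩, hab, heq⟩ := mem_image.1 h₂
    obtain ⟨rfl, rfl⟩ := Prod.mk.inj heq
    obtain ⟨i, hi⟩ := (mem_filter.1 h₁).2
    obtain ⟨j, hj⟩ := (mem_filter.1 hab).2
    refine hdd i j ?_
    rw [← hi, ← hj]
    simp
  have hsub : edgePairs F ∪ (edgePairs F).image Prod.swap ⊆ F.offDiag := by
    have h : ∀ x y, (x, y) ∈ edgePairs F → x ∈ F ∧ y ∈ F ∧ x ≠ y := by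
      intro x y h
      simp only [edgePairs, mem_filter, mem_product] at h
      obtain ⟨⟨hx, hy⟩, i, hi⟩ := h
      refine ⟨hx, hy, ?_⟩
      rintro rfl
      exact hd i (by rw [← hi, sub_self])
    refine union_subset ?_ ?_
    · rintro ⟨x, y⟩ hxy
      exact mem_offDiag.2 (h x y hxy)
    · rintro ⟨x, y⟩ hxy
      obtain ⟨⟨a, b⟩, hab, heq⟩ := mem_image.1 hxy
      obtain ⟨rfl, rfl⟩ := Prod.mk.inj heq
      have := h a b hab
      exact mem_offDiag.2 ⟨this.2.1, this.1, this.2.2.symm⟩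
  have := card_le_card hsub
  rw [card_union_of_disjoint hdisj, card_image_of_injective _ Prod.swap_injective,
    offDiag_card] at this
  omega

/-! ### Counting lattice points and the isoperimetric inequality -/

/-- The lattice triangle of the pairs `(i, j)` of natural numbers with `i + j < t`. -/
def triangle (t : ℕ) : Finset (ℕ × ℕ) := (range t).biUnion antidiagonal

lemma mem_triangle {t : ℕ} {x : ℕ × ℕ} : x ∈ triangle t ↔ x.1 + x.2 < t := by
  simp [triangle]

lemma two_mul_card_triangle (t : ℕ) : 2 * #(triangle t) = t * (t + 1) := by
  have h : #(triangle t) = ∑ k ∈ range t, (k + 1) := by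
    rw [triangle, card_biUnion]
    · simp
    · intro i _ j _ hij
      simp only [Finset.disjoint_left, HasAntidiagonal.mem_antidiagonal]
      rintro x h h'
      exact hij (h.symm.trans h')
  rw [h]
  clear h
  induction t with
  | zero => simp
  | succ n ih => rw [sum_range_succ, mul_add, ih]; ring

/-- Passing from `X` to `Y` loses at least the `t (t + 1) / 2` points of a lattice triangle with
apex `v` and sides along `α` and `β`, if this triangle lies in `X` and avoids `Y`. -/
lemma card_add_triangle_le {X Y : Finset (ℤ × ℤ)} (hYX : Y ⊆ X) (v α β : ℤ × ℤ)
    (hdet : α.1 * β.2 - α.2 * β.1 ≠ 0) {t : ℤ} (ht : 0 ≤ t)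
    (h : ∀ i j : ℤ, 0 ≤ i → 0 ≤ j → i + j < t →
      (v.1 + i * α.1 + j * β.1, v.2 + i * α.2 + j * β.2) ∈ X ∧
      (v.1 + i * α.1 + j * β.1, v.2 + i * α.2 + j * β.2) ∉ Y) :
    2 * (#Y : ℤ) + t * (t + 1) ≤ 2 * #X := by
  lift t to ℕ using ht
  let f : ℕ × ℕ → ℤ × ℤ := fun x =>
    (v.1 + x.1 * α.1 + x.2 * β.1, v.2 + x.1 * α.2 + x.2 * β.2)
  have hf : Function.Injective f := by
    rintro ⟨a, b⟩ ⟨c, d⟩ hab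
    simp only [f, Prod.mk.injEq] at hab ⊢
    have h₁ : ((a : ℤ) - c) * (α.1 * β.2 - α.2 * β.1) = 0 := by
      linear_combination β.2 * hab.1 - β.1 * hab.2
    have h₂ : ((b : ℤ) - d) * (α.1 * β.2 - α.2 * β.1) = 0 := by
      linear_combination α.1 * hab.2 - α.2 * hab.1
    have h₃ := (mul_eq_zero.1 h₁).resolve_right hdet
    have h₄ := (mul_eq_zero.1 h₂).resolve_right hdet
    omega
  have hmem : ∀ x ∈ triangle t, f x ∈ X ∧ f x ∉ Y := by
    intro x hx
    rw [mem_triangle] at hx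
    exact h x.1 x.2 (by omega) (by omega) (by omega)
  have hsub : (triangle t).image f ⊆ X \ Y := by
    intro z hz
    obtain ⟨x, hx, rfl⟩ := mem_image.1 hz
    exact mem_sdiff.2 (hmem x hx)
  have h₁ := card_le_card hsub
  rw [card_image_of_injective _ hf, card_sdiff_of_subset hYX] at h₁
  have h₂ := card_le_card hYX
  have h₃ := two_mul_card_triangle t
  have h₄ : 2 * #Y + t * (t + 1) ≤ 2 * #X := by omega
  exact_mod_cast h₄

lemma card_filter_add_triangle_le {X : Finset (ℤ × ℤ)} (P : ℤ × ℤ → Prop) [DecidablePred P]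
    (v α β : ℤ × ℤ)
    (hdet : α.1 * β.2 - α.2 * β.1 ≠ 0) {t : ℤ} (ht : 0 ≤ t)
    (h : ∀ i j : ℤ, 0 ≤ i → 0 ≤ j → i + j < t →
      (v.1 + i * α.1 + j * β.1, v.2 + i * α.2 + j * β.2) ∈ X ∧
      ¬ P (v.1 + i * α.1 + j * β.1, v.2 + i * α.2 + j * β.2)) :
    2 * (#(X.filter P) : ℤ) + t * (t + 1) ≤ 2 * #X :=
  card_add_triangle_le (filter_subset _ _) v α β hdet ht fun i j hi hj hij =>
    ⟨(h i j hi hj hij).1, fun hm => (h i j hi hj hij).2 (mem_filter.1 hm).2⟩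

lemma card_bigTriangle_le (p₀ q₀ r₁ : ℤ) (h : p₀ + q₀ ≤ r₁ + 1) :
    2 * (#((Icc p₀ (r₁ - q₀) ×ˢ Icc q₀ (r₁ - p₀)).filter fun z => z.1 + z.2 ≤ r₁) : ℤ) ≤
      (r₁ - p₀ - q₀ + 1) * (r₁ - p₀ - q₀ + 2) := by
  obtain ⟨t, ht⟩ := Int.eq_ofNat_of_zero_le (show 0 ≤ r₁ - p₀ - q₀ + 1 by omega)
  have hsub : ((Icc p₀ (r₁ - q₀) ×ˢ Icc q₀ (r₁ - p₀)).filter fun z => z.1 + z.2 ≤ r₁) ⊆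
      (triangle t).image fun x => (p₀ + x.1, q₀ + x.2) := by
    rintro ⟨p, q⟩ hz
    simp only [mem_filter, mem_product, mem_Icc] at hz
    refine mem_image.2 ⟨((p - p₀).toNat, (q - q₀).toNat), mem_triangle.2 ?_, ?_⟩
    · simp only
      omega
    · simp only [Prod.mk.injEq]
      omega
  have h₁ := (card_le_card hsub).trans card_image_le
  have h₃ := two_mul_card_triangle t
  have h₄ : 2 * #((Icc p₀ (r₁ - q₀) ×ˢ Icc q₀ (r₁ - p₀)).filter fun z => z.1 + z.2 ≤ r₁) ≤
    t * (t + 1) := by omega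
  rw [show r₁ - p₀ - q₀ + 2 = (r₁ - p₀ - q₀ + 1) + 1 by ring, ht]
  exact_mod_cast h₄

/-- The point count of a `12`-gon given by its supporting numbers: from the triangle `p₀ ≤ p`,
`q₀ ≤ q`, `p + q ≤ r₁` the other nine half-planes cut off nine disjoint lattice triangles. The first
six inequalities assumed say that the `tᵢ` are nonnegative, the others that the `uᵢ` are. -/
lemma card_polygon_le (F : Finset (ℤ × ℤ)) (p₀ p₁ q₀ q₁ r₀ r₁ a₀ a₁ b₀ b₁ c₀ c₁ : ℤ)
    (hF : ∀ z ∈ F, (p₀ ≤ z.1 ∧ z.1 ≤ p₁) ∧ (q₀ ≤ z.2 ∧ z.2 ≤ q₁) ∧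
      (r₀ ≤ z.1 + z.2 ∧ z.1 + z.2 ≤ r₁) ∧ (a₀ ≤ z.2 - z.1 ∧ z.2 - z.1 ≤ a₁) ∧
      (b₀ ≤ 2 * z.1 + z.2 ∧ 2 * z.1 + z.2 ≤ b₁) ∧ (c₀ ≤ z.1 + 2 * z.2 ∧ z.1 + 2 * z.2 ≤ c₁))
    (ht₁ : q₀ - p₁ ≤ a₀) (ht₂ : b₁ ≤ p₁ + r₁) (ht₃ : c₁ ≤ r₁ + q₁) (ht₄ : a₁ ≤ q₁ - p₀)
    (ht₅ : p₀ + r₀ ≤ b₀) (ht₆ : r₀ + q₀ ≤ c₀)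
    (hu₁ : a₀ + c₀ ≤ 3 * q₀) (hu₂ : 3 * p₁ + a₀ ≤ b₁) (hu₃ : 3 * r₁ ≤ b₁ + c₁)
    (hu₄ : 3 * q₁ ≤ c₁ + a₁) (hu₅ : b₀ ≤ a₁ + 3 * p₀) (hu₆ : b₀ + c₀ ≤ 3 * r₀) :
    2 * (#F : ℤ) + (r₁ - q₀ - p₁) * (r₁ - q₀ - p₁ + 1) + (r₁ - p₀ - q₁) * (r₁ - p₀ - q₁ + 1) +
      (r₀ - p₀ - q₀) * (r₀ - p₀ - q₀ + 1) + (a₀ - q₀ + p₁) * (a₀ - q₀ + p₁ + 1) +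
      (p₁ + r₁ - b₁) * (p₁ + r₁ - b₁ + 1) + (r₁ + q₁ - c₁) * (r₁ + q₁ - c₁ + 1) +
      (q₁ - p₀ - a₁) * (q₁ - p₀ - a₁ + 1) + (b₀ - p₀ - r₀) * (b₀ - p₀ - r₀ + 1) +
      (c₀ - r₀ - q₀) * (c₀ - r₀ - q₀ + 1) ≤ (r₁ - p₀ - q₀ + 1) * (r₁ - p₀ - q₀ + 2) := by
  have h₀ := card_bigTriangle_le p₀ q₀ r₁ (by omega)
  set X₀ := (Icc p₀ (r₁ - q₀) ×ˢ Icc q₀ (r₁ - p₀)).filter fun z => z.1 + z.2 ≤ r₁ with hX₀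
  have h₁ := card_filter_add_triangle_le (X := X₀) (fun z => z.1 ≤ p₁) (p₁ + 1, q₀) (1, 0) (0, 1)
    (t := r₁ - q₀ - p₁) (by simp) (by omega) (fun i j hi hj hij => by
      simp only [hX₀, mem_filter, mem_product, mem_Icc]; omega)
  set X₁ := X₀.filter fun z => z.1 ≤ p₁ with hX₁
  have h₂ := card_filter_add_triangle_le (X := X₁) (fun z => z.2 ≤ q₁) (p₀, q₁ + 1) (1, 0) (0, 1)
    (t := r₁ - p₀ - q₁) (by simp) (by omega) (fun i j hi hj hij => by
      simp only [hX₁, hX₀, mem_filter, mem_product, mem_Icc]; omega)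
  set X₂ := X₁.filter fun z => z.2 ≤ q₁ with hX₂
  have h₃ := card_filter_add_triangle_le (X := X₂) (fun z => r₀ ≤ z.1 + z.2) (p₀, q₀) (1, 0) (0, 1)
    (t := r₀ - p₀ - q₀) (by simp) (by omega) (fun i j hi hj hij => by
      simp only [hX₂, hX₁, hX₀, mem_filter, mem_product, mem_Icc]; omega)
  set X₃ := X₂.filter fun z => r₀ ≤ z.1 + z.2 with hX₃
  have h₄ := card_filter_add_triangle_le (X := X₃) (fun z => a₀ ≤ z.2 - z.1) (p₁, q₀)
    (-1, 0) (0, 1) (t := a₀ - q₀ + p₁) (by simp) (by omega) (fun i j hi hj hij => by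
      simp only [hX₃, hX₂, hX₁, hX₀, mem_filter, mem_product, mem_Icc]; omega)
  set X₄ := X₃.filter fun z => a₀ ≤ z.2 - z.1 with hX₄
  have h₅ := card_filter_add_triangle_le (X := X₄) (fun z => 2 * z.1 + z.2 ≤ b₁) (p₁, r₁ - p₁)
    (0, -1) (-1, 1) (t := p₁ + r₁ - b₁) (by simp) (by omega) (fun i j hi hj hij => by
      simp only [hX₄, hX₃, hX₂, hX₁, hX₀, mem_filter, mem_product, mem_Icc]; omega)
  set X₅ := X₄.filter fun z => 2 * z.1 + z.2 ≤ b₁ with hX₅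
  have h₆ := card_filter_add_triangle_le (X := X₅) (fun z => z.1 + 2 * z.2 ≤ c₁) (r₁ - q₁, q₁)
    (1, -1) (-1, 0) (t := r₁ + q₁ - c₁) (by simp) (by omega) (fun i j hi hj hij => by
      simp only [hX₅, hX₄, hX₃, hX₂, hX₁, hX₀, mem_filter, mem_product, mem_Icc]; omega)
  set X₆ := X₅.filter fun z => z.1 + 2 * z.2 ≤ c₁ with hX₆
  have h₇ := card_filter_add_triangle_le (X := X₆) (fun z => z.2 - z.1 ≤ a₁) (p₀, q₁)
    (1, 0) (0, -1) (t := q₁ - p₀ - a₁) (by simp) (by omega) (fun i j hi hj hij => by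
      simp only [hX₆, hX₅, hX₄, hX₃, hX₂, hX₁, hX₀, mem_filter, mem_product, mem_Icc]; omega)
  set X₇ := X₆.filter fun z => z.2 - z.1 ≤ a₁ with hX₇
  have h₈ := card_filter_add_triangle_le (X := X₇) (fun z => b₀ ≤ 2 * z.1 + z.2) (p₀, r₀ - p₀)
    (0, 1) (1, -1) (t := b₀ - p₀ - r₀) (by simp) (by omega) (fun i j hi hj hij => by
      simp only [hX₇, hX₆, hX₅, hX₄, hX₃, hX₂, hX₁, hX₀, mem_filter, mem_product, mem_Icc]; omega)
  set X₈ := X₇.filter fun z => b₀ ≤ 2 * z.1 + z.2 with hX₈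
  have h₉ := card_filter_add_triangle_le (X := X₈) (fun z => c₀ ≤ z.1 + 2 * z.2) (r₀ - q₀, q₀)
    (1, 0) (-1, 1) (t := c₀ - r₀ - q₀) (by simp) (by omega) (fun i j hi hj hij => by
      simp only [hX₈, hX₇, hX₆, hX₅, hX₄, hX₃, hX₂, hX₁, hX₀, mem_filter, mem_product, mem_Icc]
      omega)
  set X₉ := X₈.filter fun z => c₀ ≤ z.1 + 2 * z.2 with hX₉
  have hsub : F ⊆ X₉ := by
    intro z hz
    have := hF z hz
    simp only [hX₉, hX₈, hX₇, hX₆, hX₅, hX₄, hX₃, hX₂, hX₁, hX₀, mem_filter, mem_product, mem_Icc]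
    omega
  have h : (#F : ℤ) ≤ #X₉ := by exact_mod_cast card_le_card hsub
  linarith

lemma one_le_sq_of_ne {a b : ℤ} (h : a ≠ b) : 1 ≤ (a - b) ^ 2 := by
  have : 0 < (a - b) ^ 2 := by
    have := sub_ne_zero.2 h
    positivity
  omega

lemma two_le_of_ne_zero {x y : ℤ} (h : x ≠ 0 ∨ y ≠ 0) : 2 ≤ x ^ 2 + y ^ 2 + (x + y) ^ 2 := by
  have h₁ : 0 < x ^ 2 + y ^ 2 := by
    rcases h with h | h <;> positivity
  have h₂ : 0 < x ^ 2 + x * y + y ^ 2 := by nlinarith [sq_nonneg (x + y)]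
  linarith

lemma le_of_equilateral (m d : ℤ) :
    33 ≤ 9 * (2 * m - d) ^ 2 + 24 * d ^ 2 ∨ m = 0 ∧ d = 0 := by
  by_cases hd0 : d = 0
  · subst hd0
    by_cases hm : m = 0
    · exact Or.inr ⟨hm, rfl⟩
    · have := one_le_sq_of_ne hm
      left
      linarith
  · left
    by_cases hd1 : 2 ≤ d ∨ d ≤ -2
    · have : 4 ≤ d ^ 2 := by rcases hd1 with h | h <;> nlinarith
      linarith [sq_nonneg (2 * m - d)]
    · have h₁ := one_le_sq_of_ne hd0
      have h₂ := one_le_sq_of_ne (show 2 * m ≠ d by omega)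
      linarith

/-- In the critical case, where `δ` and the first square vanish, `x ≡ y` modulo `3`. This makes the
middle form divisible by `6`, which is more than its minimum `2`. -/
lemma le_of_not_equilateral (s t δ x y : ℤ) (h : x ≠ 0 ∨ y ≠ 0) :
    33 ≤ (6 * s + 3 * δ + 2 * x - 2 * y - 18 * t - 6) ^ 2 +
      16 * (x ^ 2 + y ^ 2 + (x + y) ^ 2) + 24 * δ ^ 2 := by
  have hge := two_le_of_ne_zero h
  by_cases hδ : δ = 0
  · by_cases hs : 6 * s + 3 * δ + 2 * x - 2 * y - 18 * t - 6 = 0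
    · obtain ⟨z, rfl⟩ : ∃ z, x = y + 3 * z := ⟨1 + 3 * t - s, by omega⟩
      have : (y + 3 * z) ^ 2 + y ^ 2 + (y + 3 * z + y) ^ 2 =
        6 * (y ^ 2 + 3 * (y * z) + 3 * z ^ 2) := by ring
      rw [hs, hδ]
      omega
    · have := one_le_sq_of_ne hs
      rw [sub_zero] at this
      linarith [sq_nonneg δ]
  · have := one_le_sq_of_ne hδ
    rw [sub_zero] at this
    linarith [sq_nonneg (6 * s + 3 * δ + 2 * x - 2 * y - 18 * t - 6)]

/-- The integer inequality behind the isoperimetric bound. Here `s₁, s₂, s₃` are consecutive sides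
of the hexagon, whose opposite sides are `s₁ - δ, s₂ + δ, s₃ - δ`; `A, B, C` are the sums of opposite
sides, and the `tᵢ` are the sizes of its cut corners. If the `tᵢ` are not all equal, the last sum is
at least `5`. -/
lemma isoperimetric_aux (s₁ s₂ s₃ δ t₁ t₂ t₃ t₄ t₅ t₆ : ℤ)
    (A B C : ℤ) (hA : A = 2 * s₁ - δ) (hB : B = 2 * s₂ + δ) (hC : C = 2 * s₃ - δ) :
    33 ≤ (A + B + C - 3 * (t₁ + t₂ + t₃ + t₄ + t₅ + t₆) - 6) ^ 2 +
      4 * ((A - B) ^ 2 + (B - C) ^ 2 + (A - C) ^ 2) + 24 * δ ^ 2 +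
      8 * ((t₁ - t₂) ^ 2 + (t₁ - t₃) ^ 2 + (t₁ - t₄) ^ 2 + (t₁ - t₅) ^ 2 + (t₁ - t₆) ^ 2 +
        (t₂ - t₃) ^ 2 + (t₂ - t₄) ^ 2 + (t₂ - t₅) ^ 2 + (t₂ - t₆) ^ 2 + (t₃ - t₄) ^ 2 +
        (t₃ - t₅) ^ 2 + (t₃ - t₆) ^ 2 + (t₄ - t₅) ^ 2 + (t₄ - t₆) ^ 2 + (t₅ - t₆) ^ 2) ∨
    (δ = 0 ∧ s₂ = s₁ ∧ s₃ = s₁ ∧ t₂ = t₁ ∧ t₃ = t₁ ∧ t₄ = t₁ ∧ t₅ = t₁ ∧ t₆ = t₁ ∧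
      s₁ = 3 * t₁ + 1) := by
  have hpos : 0 ≤ (A + B + C - 3 * (t₁ + t₂ + t₃ + t₄ + t₅ + t₆) - 6) ^ 2 +
      4 * ((A - B) ^ 2 + (B - C) ^ 2 + (A - C) ^ 2) + 24 * δ ^ 2 := by positivity
  have key : ∀ a b c : ℤ, a ≠ b → 1 ≤ (a - c) ^ 2 + (b - c) ^ 2 := by
    intro a b c hab
    by_cases h : a = c
    · have := one_le_sq_of_ne (h ▸ hab.symm)
      nlinarith [sq_nonneg (a - c)]
    · have := one_le_sq_of_ne h
      nlinarith [sq_nonneg (b - c)]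
  have sym : ∀ a b : ℤ, (a - b) ^ 2 = (b - a) ^ 2 := fun a b => by ring
  by_cases h₂ : t₂ = t₁
  swap
  · left
    have := one_le_sq_of_ne h₂
    have := key _ _ t₃ h₂
    have := key _ _ t₄ h₂
    have := key _ _ t₅ h₂
    have := key _ _ t₆ h₂
    have := sym t₁ t₂
    linarith [sq_nonneg (t₃ - t₄), sq_nonneg (t₃ - t₅), sq_nonneg (t₃ - t₆), sq_nonneg (t₄ - t₅),
      sq_nonneg (t₄ - t₆), sq_nonneg (t₅ - t₆)]
  by_cases h₃ : t₃ = t₁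
  swap
  · left
    have := one_le_sq_of_ne h₃
    have := key _ _ t₂ h₃
    have := key _ _ t₄ h₃
    have := key _ _ t₅ h₃
    have := key _ _ t₆ h₃
    have := sym t₁ t₃
    have := sym t₂ t₃
    linarith [sq_nonneg (t₂ - t₄), sq_nonneg (t₂ - t₅), sq_nonneg (t₂ - t₆), sq_nonneg (t₄ - t₅),
      sq_nonneg (t₄ - t₆), sq_nonneg (t₅ - t₆)]
  by_cases h₄ : t₄ = t₁
  swap
  · left
    have := one_le_sq_of_ne h₄
    have := key _ _ t₂ h₄
    have := key _ _ t₃ h₄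
    have := key _ _ t₅ h₄
    have := key _ _ t₆ h₄
    have := sym t₁ t₄
    have := sym t₂ t₄
    have := sym t₃ t₄
    linarith [sq_nonneg (t₂ - t₃), sq_nonneg (t₂ - t₅), sq_nonneg (t₂ - t₆), sq_nonneg (t₃ - t₅),
      sq_nonneg (t₃ - t₆), sq_nonneg (t₅ - t₆)]
  by_cases h₅ : t₅ = t₁
  swap
  · left
    have := one_le_sq_of_ne h₅
    have := key _ _ t₂ h₅
    have := key _ _ t₃ h₅
    have := key _ _ t₄ h₅
    have := key _ _ t₆ h₅
    have := sym t₁ t₅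
    have := sym t₂ t₅
    have := sym t₃ t₅
    have := sym t₄ t₅
    linarith [sq_nonneg (t₂ - t₃), sq_nonneg (t₂ - t₄), sq_nonneg (t₂ - t₆), sq_nonneg (t₃ - t₄),
      sq_nonneg (t₃ - t₆), sq_nonneg (t₄ - t₆)]
  by_cases h₆ : t₆ = t₁
  swap
  · left
    have := one_le_sq_of_ne h₆
    have := key _ _ t₂ h₆
    have := key _ _ t₃ h₆
    have := key _ _ t₄ h₆
    have := key _ _ t₅ h₆
    have := sym t₁ t₆
    have := sym t₂ t₆
    have := sym t₃ t₆
    have := sym t₄ t₆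
    have := sym t₅ t₆
    linarith [sq_nonneg (t₂ - t₃), sq_nonneg (t₂ - t₄), sq_nonneg (t₂ - t₅), sq_nonneg (t₃ - t₄),
      sq_nonneg (t₃ - t₅), sq_nonneg (t₄ - t₅)]
  rw [h₂, h₃, h₄, h₅, h₆, hA, hB, hC]
  by_cases hD : 2 * s₁ - δ = 2 * s₂ + δ ∧ 2 * s₂ + δ = 2 * s₃ - δ
  · obtain ⟨hD₁, hD₂⟩ := hD
    obtain rfl : s₃ = s₁ := by omega
    obtain rfl : δ = s₃ - s₂ := by omega
    obtain ⟨m, rfl⟩ : ∃ m, s₃ = m + 3 * t₁ + 1 := ⟨s₃ - 3 * t₁ - 1, by ring⟩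
    obtain ⟨d, rfl⟩ : ∃ d, s₂ = m + 3 * t₁ + 1 - d := ⟨m + 3 * t₁ + 1 - s₂, by ring⟩
    rcases le_of_equilateral m d with hd | ⟨rfl, rfl⟩
    · left
      refine hd.trans_eq ?_
      ring
    · right
      omega
  · left
    obtain ⟨x, hx⟩ : ∃ x, s₁ - s₂ - δ = x := ⟨_, rfl⟩
    obtain ⟨y, hy⟩ : ∃ y, s₂ - s₃ + δ = y := ⟨_, rfl⟩
    obtain rfl : s₁ = x + s₂ + δ := by omega
    obtain rfl : s₃ = s₂ + δ - y := by omega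
    have hxy : x ≠ 0 ∨ y ≠ 0 := by omega
    refine (le_of_not_equilateral s₂ t₁ δ x y hxy).trans_eq ?_
    ring

/-! ### The bound in integer coordinates -/

/-- The lower bound for the number `W` of lines in terms of the supporting numbers, with the
exceptional polygons given by their centre `(x, y)` and `t = k - 1`. -/
lemma isoperimetric (n p₀ p₁ q₀ q₁ r₀ r₁ a₀ a₁ b₀ b₁ c₀ c₁ W : ℤ)
    (hcount : 2 * n + (r₁ - q₀ - p₁) * (r₁ - q₀ - p₁ + 1) +
      (r₁ - p₀ - q₁) * (r₁ - p₀ - q₁ + 1) +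
      (r₀ - p₀ - q₀) * (r₀ - p₀ - q₀ + 1) + (a₀ - q₀ + p₁) * (a₀ - q₀ + p₁ + 1) +
      (p₁ + r₁ - b₁) * (p₁ + r₁ - b₁ + 1) + (r₁ + q₁ - c₁) * (r₁ + q₁ - c₁ + 1) +
      (q₁ - p₀ - a₁) * (q₁ - p₀ - a₁ + 1) + (b₀ - p₀ - r₀) * (b₀ - p₀ - r₀ + 1) +
      (c₀ - r₀ - q₀) * (c₀ - r₀ - q₀ + 1) ≤ (r₁ - p₀ - q₀ + 1) * (r₁ - p₀ - q₀ + 2))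
    (hW : W = (p₁ - p₀ + 1) + (q₁ - q₀ + 1) + (r₁ - r₀ + 1) + (a₁ - a₀ + 1) + (b₁ - b₀ + 1) +
      (c₁ - c₀ + 1)) :
    96 * n - 63 ≤ W ^ 2 ∨ (96 * n - 96 ≤ W ^ 2 ∧
      ∃ x y t, p₀ = x - (3 * t + 1) ∧ p₁ = x + (3 * t + 1) ∧ q₀ = y - (3 * t + 1) ∧
        q₁ = y + (3 * t + 1) ∧ r₀ = x + y - (3 * t + 1) ∧ r₁ = x + y + (3 * t + 1) ∧
        a₀ = y - x - (5 * t + 2) ∧ a₁ = y - x + (5 * t + 2) ∧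
        b₀ = 2 * x + y - (5 * t + 2) ∧ b₁ = 2 * x + y + (5 * t + 2) ∧
        c₀ = x + 2 * y - (5 * t + 2) ∧ c₁ = x + 2 * y + (5 * t + 2)) := by
  obtain ⟨s₁, hs₁⟩ : ∃ s₁, s₁ = p₁ - r₀ + q₀ := ⟨_, rfl⟩
  obtain ⟨s₂, hs₂⟩ : ∃ s₂, s₂ = r₁ - p₁ - q₀ := ⟨_, rfl⟩
  obtain ⟨s₃, hs₃⟩ : ∃ s₃, s₃ = p₁ + q₁ - r₁ := ⟨_, rfl⟩
  obtain ⟨δ, hδ⟩ : ∃ δ, δ = p₁ - r₀ + q₀ - (r₁ - q₁ - p₀) := ⟨_, rfl⟩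
  obtain ⟨t₁, ht₁⟩ : ∃ t₁, t₁ = a₀ - q₀ + p₁ := ⟨_, rfl⟩
  obtain ⟨t₂, ht₂⟩ : ∃ t₂, t₂ = p₁ + r₁ - b₁ := ⟨_, rfl⟩
  obtain ⟨t₃, ht₃⟩ : ∃ t₃, t₃ = r₁ + q₁ - c₁ := ⟨_, rfl⟩
  obtain ⟨t₄, ht₄⟩ : ∃ t₄, t₄ = q₁ - p₀ - a₁ := ⟨_, rfl⟩
  obtain ⟨t₅, ht₅⟩ : ∃ t₅, t₅ = b₀ - p₀ - r₀ := ⟨_, rfl⟩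
  obtain ⟨t₆, ht₆⟩ : ∃ t₆, t₆ = c₀ - r₀ - q₀ := ⟨_, rfl⟩
  have hid : (2 * s₁ - δ + (2 * s₂ + δ) + (2 * s₃ - δ) -
        3 * (t₁ + t₂ + t₃ + t₄ + t₅ + t₆) - 6) ^ 2 +
      4 * ((2 * s₁ - δ - (2 * s₂ + δ)) ^ 2 + (2 * s₂ + δ - (2 * s₃ - δ)) ^ 2 +
        (2 * s₁ - δ - (2 * s₃ - δ)) ^ 2) + 24 * δ ^ 2 +
      8 * ((t₁ - t₂) ^ 2 + (t₁ - t₃) ^ 2 + (t₁ - t₄) ^ 2 + (t₁ - t₅) ^ 2 + (t₁ - t₆) ^ 2 +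
        (t₂ - t₃) ^ 2 + (t₂ - t₄) ^ 2 + (t₂ - t₅) ^ 2 + (t₂ - t₆) ^ 2 + (t₃ - t₄) ^ 2 +
        (t₃ - t₅) ^ 2 + (t₃ - t₆) ^ 2 + (t₄ - t₅) ^ 2 + (t₄ - t₆) ^ 2 + (t₅ - t₆) ^ 2) =
      W ^ 2 + 96 - 48 * ((r₁ - p₀ - q₀ + 1) * (r₁ - p₀ - q₀ + 2) -
      ((r₁ - q₀ - p₁) * (r₁ - q₀ - p₁ + 1) + (r₁ - p₀ - q₁) * (r₁ - p₀ - q₁ + 1) +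
      (r₀ - p₀ - q₀) * (r₀ - p₀ - q₀ + 1) + (a₀ - q₀ + p₁) * (a₀ - q₀ + p₁ + 1) +
      (p₁ + r₁ - b₁) * (p₁ + r₁ - b₁ + 1) + (r₁ + q₁ - c₁) * (r₁ + q₁ - c₁ + 1) +
      (q₁ - p₀ - a₁) * (q₁ - p₀ - a₁ + 1) + (b₀ - p₀ - r₀) * (b₀ - p₀ - r₀ + 1) +
      (c₀ - r₀ - q₀) * (c₀ - r₀ - q₀ + 1))) := by
    subst hs₁ hs₂ hs₃ hδ ht₁ ht₂ ht₃ ht₄ ht₅ ht₆ hW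
    ring
  rcases isoperimetric_aux s₁ s₂ s₃ δ t₁ t₂ t₃ t₄ t₅ t₆ _ _ _ rfl rfl rfl with h | h
  · left
    linarith
  · right
    refine ⟨?_, p₀ + s₁, q₀ + s₁, t₁, ?_⟩
    · have : 0 ≤ (2 * s₁ - δ + (2 * s₂ + δ) + (2 * s₃ - δ) -
        3 * (t₁ + t₂ + t₃ + t₄ + t₅ + t₆) - 6) ^ 2 +
      4 * ((2 * s₁ - δ - (2 * s₂ + δ)) ^ 2 + (2 * s₂ + δ - (2 * s₃ - δ)) ^ 2 +
        (2 * s₁ - δ - (2 * s₃ - δ)) ^ 2) + 24 * δ ^ 2 +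
      8 * ((t₁ - t₂) ^ 2 + (t₁ - t₃) ^ 2 + (t₁ - t₄) ^ 2 + (t₁ - t₅) ^ 2 + (t₁ - t₆) ^ 2 +
        (t₂ - t₃) ^ 2 + (t₂ - t₄) ^ 2 + (t₂ - t₅) ^ 2 + (t₂ - t₆) ^ 2 + (t₃ - t₄) ^ 2 +
        (t₃ - t₅) ^ 2 + (t₃ - t₆) ^ 2 + (t₄ - t₅) ^ 2 + (t₄ - t₆) ^ 2 + (t₅ - t₆) ^ 2) := by
        positivity
      linarith
    · omega

/-- `F` is the polygon with `uᵢ = t + 1` and `tᵢ = t` for all `i`, with centre `(x, y)`. -/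
def IsExceptional (F : Finset (ℤ × ℤ)) : Prop :=
  ∃ (x y : ℤ) (t : ℕ), ∀ a b : ℤ, (a, b) ∈ F ↔
    (x - (3 * t + 1) ≤ a ∧ a ≤ x + (3 * t + 1)) ∧ (y - (3 * t + 1) ≤ b ∧ b ≤ y + (3 * t + 1)) ∧
    (x + y - (3 * t + 1) ≤ a + b ∧ a + b ≤ x + y + (3 * t + 1)) ∧
    (y - x - (5 * t + 2) ≤ b - a ∧ b - a ≤ y - x + (5 * t + 2)) ∧
    (2 * x + y - (5 * t + 2) ≤ 2 * a + b ∧ 2 * a + b ≤ 2 * x + y + (5 * t + 2)) ∧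
    (x + 2 * y - (5 * t + 2) ≤ a + 2 * b ∧ a + 2 * b ≤ x + 2 * y + (5 * t + 2))

/-- The bound, with `W` the number of lines, for hulls on which no form skips a value. -/
lemma HullClosed.bound_of_not_hasWeakVertex {F : Finset (ℤ × ℤ)} (hF : HullClosed F)
    (hne : F.Nonempty) (hw : ¬ HasWeakVertex F) :
    ∃ W : ℤ, 6 ≤ W ∧ (#(edgePairs F) : ℤ) + W ≤ 6 * #F ∧
      (96 * (#F : ℤ) - 63 ≤ W ^ 2 ∨ (96 * (#F : ℤ) - 96 ≤ W ^ 2 ∧ 24 ≤ W ∧ IsExceptional F)) := by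
  have hmin := fun i => F.exists_min_image (form i) hne
  have hmax := fun i => F.exists_max_image (form i) hne
  choose lo hlo hlo' using hmin
  choose hi hhi hhi' using hmax
  have hb : ∀ z ∈ F, ∀ i, form i (lo i) ≤ form i z ∧ form i z ≤ form i (hi i) :=
    fun z hz i => ⟨hlo' i z hz, hhi' i z hz⟩
  have hmem : ∀ z, (∀ i, form i (lo i) ≤ form i z ∧ form i z ≤ form i (hi i)) → z ∈ F :=
    fun z hz => hF z fun i => ⟨⟨_, hlo i, (hz i).1⟩, _, hhi i, (hz i).2⟩
  have hwidth := fun i => hF.width_le hw i (hlo i) (hhi i)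
  have hE := card_edgePairs_le F
  have hlines := fun i => card_filter_add_card_image_form_le F i
  have hle := fun i => hlo' i _ (hhi i)
  simp only [Fin.forall_fin_succ, Fin.sum_univ_succ, form, Matrix.cons_val,
    Fin.succ_zero_eq_one, Fin.succ_one_eq_two, IsEmpty.forall_iff, and_true, Fin.reduceSucc,
    Finset.univ_eq_empty, Finset.sum_empty, add_zero] at hb hmem hwidth hE hlines hle
  have ht₁ : (lo 1).2 - (hi 0).1 ≤ (lo 3).2 - (lo 3).1 := by have := hb _ (hlo 3); omega
  have hcount := card_polygon_le F _ _ _ _ _ _ _ _ _ _ _ _ hb ht₁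
    (by have := hb _ (hhi 4); omega) (by have := hb _ (hhi 5); omega)
    (by have := hb _ (hhi 3); omega) (by have := hb _ (hlo 4); omega)
    (by have := hb _ (hlo 5); omega) (by have := hb _ (hlo 1); omega)
    (by have := hb _ (hhi 0); omega) (by have := hb _ (hhi 2); omega)
    (by have := hb _ (hhi 1); omega) (by have := hb _ (hlo 0); omega)
    (by have := hb _ (hlo 2); omega)
  refine ⟨_, ?_, ?_, (isoperimetric _ _ _ _ _ _ _ _ _ _ _ _ _ _ hcount rfl).imp_right ?_⟩
  · omega
  · omega
  · rintro ⟨h, x, y, t, h₁, h₂, h₃, h₄, h₅, h₆, h₇, h₈, h₉, h₁₀, h₁₁, h₁₂⟩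
    have ht : 0 ≤ t := by omega
    lift t to ℕ using ht
    refine ⟨h, by omega, x, y, t, fun a b => ⟨fun hab => ?_, fun hab => hmem _ ?_⟩⟩
    · have := hb _ hab
      simpa only [h₁, h₂, h₃, h₄, h₅, h₆, h₇, h₈, h₉, h₁₀, h₁₁, h₁₂] using this
    · simpa only [h₁, h₂, h₃, h₄, h₅, h₆, h₇, h₈, h₉, h₁₀, h₁₁, h₁₂] using hab

/-- The bound in integer coordinates. Deleting a weak vertex lowers the number of points by `1` and
the number of edges by at most `3`, so `W` drops by `3`. The lower bounds `15` and `24` for `W` make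
`(W + 3)²` exceed `W²` by enough for the stronger of the two inequalities. -/
theorem HullClosed.isoperimetric_bound {F : Finset (ℤ × ℤ)} (hF : HullClosed F) (hn : 3 ≤ #F) :
    ∃ W : ℤ, 15 ≤ W ∧ (#(edgePairs F) : ℤ) + W ≤ 6 * #F ∧
      (96 * (#F : ℤ) - 63 ≤ W ^ 2 ∨ (96 * (#F : ℤ) - 96 ≤ W ^ 2 ∧ 24 ≤ W ∧ IsExceptional F)) := by
  obtain ⟨m, hm⟩ : ∃ m, #F = m + 3 := ⟨#F - 3, by omega⟩
  induction m generalizing F with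
  | zero =>
    have h := two_mul_card_edgePairs_le F
    rw [hm] at h ⊢
    exact ⟨15, le_rfl, by push_cast; omega, Or.inl (by norm_num)⟩
  | succ m ih =>
    by_cases hw : HasWeakVertex F
    · obtain ⟨v, hv, hG, hdeg⟩ := hw
      have hcard : #(F.erase v) = m + 3 := by rw [card_erase_of_mem hv]; omega
      obtain ⟨W, hW, hE, h⟩ := ih hG (by omega) hcard
      have hle := card_edgePairs_le_erase F v
      rw [hcard] at hE h
      rw [hm]
      push_cast at hE h ⊢
      refine ⟨W + 3, by omega, by omega, Or.inl ?_⟩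
      rcases h with h | ⟨h, h', -⟩ <;> nlinarith
    · obtain ⟨W, hW, hE, h⟩ := hF.bound_of_not_hasWeakVertex (card_pos.1 (by omega)) hw
      refine ⟨W, ?_, hE, h⟩
      rcases h with h | ⟨-, h', -⟩
      · have : (3 : ℤ) ≤ #F := by exact_mod_cast hn
        nlinarith
      · omega

/-! ### Translation to the lattice in the plane -/

/-- The lattice point with the given integer coordinates. -/
noncomputable def point (z : ℤ × ℤ) : Lam := z.1 • g₁ + z.2 • g₂

lemma point_add (z w : ℤ × ℤ) : point (z + w) = point z + point w := by
  simp only [point, Prod.fst_add, Prod.snd_add, add_smul]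
  abel

lemma point_neg (z : ℤ × ℤ) : point (-z) = -point z := by
  simp only [point, Prod.fst_neg, Prod.snd_neg, neg_smul]
  abel

lemma point_apply_zero (z : ℤ × ℤ) : (point z : Plane) 0 = z.1 + z.2 / 2 := by
  simp [point, g₁, g₂, e₁, e₂]
  ring

lemma point_apply_one (z : ℤ × ℤ) : (point z : Plane) 1 = z.2 * (√3 / 2) := by
  simp [point, g₁, g₂, e₁, e₂]

lemma det_point (z w : ℤ × ℤ) :
    det (point z) (point w) = √3 / 2 * ((z.1 * w.2 - z.2 * w.1 : ℤ) : ℝ) := by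
  simp only [det, point_apply_zero, point_apply_one]
  push_cast
  ring

lemma det_point_le_iff (e z w : ℤ × ℤ) :
    det (point e) (point z) ≤ det (point e) (point w) ↔
      e.1 * z.2 - e.2 * z.1 ≤ e.1 * w.2 - e.2 * w.1 := by
  rw [det_point, det_point, mul_le_mul_iff_right₀ (by positivity), Int.cast_le]

lemma point_injective : Function.Injective point := by
  rintro ⟨a, b⟩ ⟨c, d⟩ h
  have h₀ : (point (a, b) : Plane) 0 = (point (c, d) : Plane) 0 := by rw [h]
  have h₁ : (point (a, b) : Plane) 1 = (point (c, d) : Plane) 1 := by rw [h]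
  rw [point_apply_one, point_apply_one] at h₁
  have hb : (b : ℝ) = d := mul_right_cancel₀ (by positivity) h₁
  rw [point_apply_zero, point_apply_zero] at h₀
  have ha : (a : ℝ) = c := by
    simp only [hb] at h₀
    linarith
  rw [Int.cast_inj.1 ha, Int.cast_inj.1 hb]

lemma point_surjective : Function.Surjective point := by
  rintro ⟨_, m, n, rfl⟩
  exact ⟨(m, n), by simp [point, g₁, g₂, Subtype.ext_iff]⟩

lemma shortDir_eq (i : Fin 6) : shortDir i =
    point (![(1, 0), (0, 1), (-1, 1), (-1, 0), (0, -1), (1, -1)] i) := by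
  fin_cases i <;> simp [shortDir, point] <;> abel

lemma longDir_eq (i : Fin 6) : longDir i =
    point (![(1, 1), (-1, 2), (-2, 1), (-1, -1), (1, -2), (2, -1)] i) := by
  fin_cases i <;> simp [longDir, point] <;> abel

lemma exists_dir_of_mem_U {d : Lam} (hd : d ∈ U) :
    ∃ i, d = point (dir i) ∨ d = -point (dir i) := by
  simp only [← point_neg]
  rcases hd with ⟨i, rfl⟩ | ⟨i, rfl⟩
  · refine ⟨![1, 0, 2, 1, 0, 2] i, ?_⟩
    rw [shortDir_eq]
    fin_cases i <;> simp [dir]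
  · refine ⟨![3, 4, 5, 3, 4, 5] i, ?_⟩
    rw [longDir_eq]
    fin_cases i <;> simp [dir]

/-- The determinant with `dir i` is `form i` up to sign. -/
lemma dir_cross (i : Fin 6) :
    (∀ z : ℤ × ℤ, (dir i).1 * z.2 - (dir i).2 * z.1 = form i z) ∨
      ∀ z : ℤ × ℤ, (dir i).1 * z.2 - (dir i).2 * z.1 = -form i z := by
  fin_cases i
  · exact Or.inr fun z => by simp [dir, form]
  · exact Or.inl fun z => by simp [dir, form]
  · exact Or.inr fun z => by simp [dir, form]; ring
  · exact Or.inl fun z => by simp [dir, form]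
  · exact Or.inr fun z => by simp [dir, form]; ring
  · exact Or.inr fun z => by simp [dir, form]; ring

lemma hullClosed_of_hull {S : Set Lam} {F : Finset (ℤ × ℤ)} (hF : ∀ z, z ∈ F ↔ point z ∈ hull S) :
    HullClosed F := by
  intro z hz
  rw [hF]
  intro d hd c hc
  have key : ∀ e : ℤ × ℤ, point e = d →
      (∃ w ∈ F, e.1 * w.2 - e.2 * w.1 ≤ e.1 * z.2 - e.2 * z.1) →
      (point z : Plane) ∈ halfPlane d c := by
    rintro e rfl ⟨w, hw, hwz⟩
    have h₁ : c ≤ det (point e) (point w) := (hF w).1 hw _ hd c hc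
    exact h₁.trans ((det_point_le_iff e w z).2 hwz)
  obtain ⟨i, rfl | rfl⟩ := exists_dir_of_mem_U hd
  · refine key (dir i) rfl ?_
    obtain ⟨⟨x, hx, hxz⟩, y, hy, hyz⟩ := hz i
    rcases dir_cross i with h | h
    · exact ⟨x, hx, by rw [h, h]; exact hxz⟩
    · exact ⟨y, hy, by rw [h, h]; exact neg_le_neg hyz⟩
  · refine key (-dir i) (point_neg _) ?_
    obtain ⟨⟨x, hx, hxz⟩, y, hy, hyz⟩ := hz i
    rcases dir_cross i with h | h
    · refine ⟨y, hy, ?_⟩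
      have h₁ := h y
      have h₂ := h z
      simp only [Prod.fst_neg, Prod.snd_neg]
      linarith
    · refine ⟨x, hx, ?_⟩
      have h₁ := h x
      have h₂ := h z
      simp only [Prod.fst_neg, Prod.snd_neg]
      linarith

lemma ncard_edgeSet_le {P : LamU.Subgraph} {F : Finset (ℤ × ℤ)}
    (hF : ∀ z, z ∈ F ↔ point z ∈ P.verts) : P.edgeSet.ncard ≤ #(edgePairs F) := by
  have hsub : P.edgeSet ⊆ (fun e : (ℤ × ℤ) × (ℤ × ℤ) => s(point e.1, point e.2)) ''
      (edgePairs F : Set ((ℤ × ℤ) × (ℤ × ℤ))) := by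
    intro e he
    induction e using Sym2.ind with
    | _ a b =>
      rw [SimpleGraph.Subgraph.mem_edgeSet] at he
      have ha := he.fst_mem
      have hb := he.snd_mem
      have hadj := he.adj_sub
      obtain ⟨x, rfl⟩ := point_surjective a
      obtain ⟨y, rfl⟩ := point_surjective b
      have key : ∀ x y, x ∈ F → y ∈ F → (∃ i, point y = point x + point (dir i)) →
          (x, y) ∈ edgePairs F := by
        rintro x y hx hy ⟨i, hi⟩
        rw [← point_add] at hi
        refine mem_filter.2 ⟨mem_product.2 ⟨hx, hy⟩, i, ?_⟩
        rw [point_injective hi]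
        simp
      rw [LamU, SimpleGraph.addCayley_adj'] at hadj
      obtain ⟨-, g, hg, h⟩ := hadj
      obtain ⟨i, rfl | rfl⟩ := exists_dir_of_mem_U hg
      · rcases h with h | h
        · exact ⟨(x, y), key x y ((hF x).2 ha) ((hF y).2 hb) ⟨i, h.symm⟩, rfl⟩
        · exact ⟨(y, x), key y x ((hF y).2 hb) ((hF x).2 ha) ⟨i, h⟩, Sym2.eq_swap⟩
      · rcases h with h | h
        · exact ⟨(y, x), key y x ((hF y).2 hb) ((hF x).2 ha) ⟨i, by rw [← h]; abel⟩,
            Sym2.eq_swap⟩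
        · exact ⟨(x, y), key x y ((hF x).2 ha) ((hF y).2 hb) ⟨i, by rw [h]; abel⟩, rfl⟩
  calc P.edgeSet.ncard ≤ _ := Set.ncard_le_ncard hsub ((edgePairs F).finite_toSet.image _)
    _ ≤ (edgePairs F : Set ((ℤ × ℤ) × (ℤ × ℤ))).ncard :=
      Set.ncard_image_le (edgePairs F).finite_toSet
    _ = _ := Set.ncard_coe_finset _

/-- Computation of a side length: the side in direction `e` consists of the points `w + j e` with
`0 ≤ j ≤ m`. The form given by `c` takes the value `1` at `e`, so it recovers `j` from a point of the
side. -/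
lemma sideLength_eq {P : LamU.Subgraph} {F : Finset (ℤ × ℤ)}
    (hF : ∀ z, z ∈ F ↔ point z ∈ P.verts) (e w c : ℤ × ℤ) (m : ℕ)
    (hc : c.1 * e.1 + c.2 * e.2 = 1)
    (h₁ : ∀ j : ℤ, 0 ≤ j → j ≤ m → (w.1 + j * e.1, w.2 + j * e.2) ∈ F)
    (h₂ : ∀ a b, (a, b) ∈ F → e.1 * w.2 - e.2 * w.1 ≤ e.1 * b - e.2 * a)
    (h₃ : ∀ a b, (a, b) ∈ F → e.1 * b - e.2 * a ≤ e.1 * w.2 - e.2 * w.1 →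
      0 ≤ c.1 * (a - w.1) + c.2 * (b - w.2) ∧ c.1 * (a - w.1) + c.2 * (b - w.2) ≤ m) :
    sideLength P (point e) = m := by
  have hside : ∀ z, point z ∈ side P (point e) ↔
      z ∈ F ∧ e.1 * z.2 - e.2 * z.1 ≤ e.1 * w.2 - e.2 * w.1 := by
    intro z
    have hw : w ∈ F := by simpa using h₁ 0 le_rfl (by positivity)
    simp only [side, Set.mem_ofPred_eq, ← hF]
    refine and_congr_right fun hz => ⟨fun h => ?_, fun h y hy => ?_⟩
    · exact (det_point_le_iff _ _ _).1 (h _ ((hF w).1 hw))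
    · obtain ⟨y, rfl⟩ := point_surjective y
      exact (det_point_le_iff _ _ _).2 (h.trans (h₂ _ _ ((hF y).2 hy)))
  have himage : {x : Lam | x ∈ side P (point e) ∧ x + point e ∈ side P (point e)} =
      (fun j : ℕ => point (w.1 + j * e.1, w.2 + j * e.2)) '' (range m : Set ℕ) := by
    ext x
    obtain ⟨⟨a, b⟩, rfl⟩ := point_surjective x
    simp only [Set.mem_ofPred_eq, ← point_add, hside, Set.mem_image, coe_range, Set.mem_Iio]
    constructor
    · rintro ⟨⟨hz, hz'⟩, hze, hze'⟩
      have h₄ := h₃ _ _ hz hz'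
      have h₅ := h₃ _ _ hze hze'
      simp only at h₅ hz'
      obtain ⟨j, hj⟩ := Int.eq_ofNat_of_zero_le h₄.1
      have h₆ : c.1 * (a + e.1 - w.1) + c.2 * (b + e.2 - w.2) = j + 1 := by
        linear_combination hj + hc
      have h₇ : e.1 * b - e.2 * a = e.1 * w.2 - e.2 * w.1 := le_antisymm hz' (h₂ _ _ hz)
      refine ⟨j, by omega, congrArg point (Prod.ext ?_ ?_)⟩
      · simp only
        linear_combination -e.1 * hj + c.2 * h₇ + (a - w.1) * hc
      · simp only
        linear_combination -e.2 * hj - c.1 * h₇ + (b - w.2) * hc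
    · rintro ⟨j, hj, hjz⟩
      have := point_injective hjz
      obtain ⟨rfl, rfl⟩ := Prod.mk.inj this
      refine ⟨⟨h₁ j (by positivity) (by omega), le_of_eq (by ring)⟩, ?_, le_of_eq ?_⟩
      · convert h₁ (j + 1) (by positivity) (by omega) using 1
        exact Prod.ext (by simp only [Prod.fst_add]; ring) (by simp only [Prod.snd_add]; ring)
      · simp only [Prod.fst_add, Prod.snd_add]
        ring
  rw [sideLength, himage, Set.ncard_image_of_injective _ ?_, Set.ncard_coe_finset, card_range]
  intro i j hij
  have := point_injective hij
  rw [Prod.mk.injEq] at this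
  have h : (i : ℤ) = j := by
    linear_combination c.1 * this.1 + c.2 * this.2 + (j - i) * hc
  exact_mod_cast h

lemma IsExceptional.exists_u_t_eq {P : LamU.Subgraph} {F : Finset (ℤ × ℤ)}
    (hF : ∀ z, z ∈ F ↔ point z ∈ P.verts) (h : IsExceptional F) :
    ∃ k : ℕ, ∀ i : Fin 6, u P i = k ∧ t P i + 1 = k := by
  obtain ⟨x, y, m, hm⟩ := h
  have hu : ∀ i, u P i = m + 1 := by
    intro i
    rw [u, shortDir_eq]
    match i with
    | 0 =>
      refine sideLength_eq hF (1, 0) (x + m, y - 3 * m - 1) (1, 0) (m + 1)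
        ?_ ?_ ?_ ?_ <;>
        simp only [hm] <;> push_cast <;> omega
    | 1 =>
      refine sideLength_eq hF (0, 1) (x + 3 * m + 1, y - 2 * m - 1) (0, 1) (m + 1)
        ?_ ?_ ?_ ?_ <;>
        simp only [hm] <;> push_cast <;> omega
    | 2 =>
      refine sideLength_eq hF (-1, 1) (x + 2 * m + 1, y + m) (0, 1) (m + 1)
        ?_ ?_ ?_ ?_ <;>
        simp only [hm] <;> push_cast <;> omega
    | 3 =>
      refine sideLength_eq hF (-1, 0) (x - m, y + 3 * m + 1) (-1, 0) (m + 1)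
        ?_ ?_ ?_ ?_ <;>
        simp only [hm] <;> push_cast <;> omega
    | 4 =>
      refine sideLength_eq hF (0, -1) (x - 3 * m - 1, y + 2 * m + 1) (0, -1) (m + 1)
        ?_ ?_ ?_ ?_ <;>
        simp only [hm] <;> push_cast <;> omega
    | 5 =>
      refine sideLength_eq hF (1, -1) (x - 2 * m - 1, y - m) (1, 0) (m + 1)
        ?_ ?_ ?_ ?_ <;>
        simp only [hm] <;> push_cast <;> omega
  have ht : ∀ i, t P i = m := by
    intro i
    rw [t, longDir_eq]
    match i with
    | 0 =>
      refine sideLength_eq hF (1, 1) (x + 2 * m + 1, y - 3 * m - 1) (1, 0) m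
        ?_ ?_ ?_ ?_ <;>
        simp only [hm] <;> omega
    | 1 =>
      refine sideLength_eq hF (-1, 2) (x + 3 * m + 1, y - m) (-1, 0) m
        ?_ ?_ ?_ ?_ <;>
        simp only [hm] <;> omega
    | 2 =>
      refine sideLength_eq hF (-2, 1) (x + m, y + 2 * m + 1) (0, 1) m
        ?_ ?_ ?_ ?_ <;>
        simp only [hm] <;> omega
    | 3 =>
      refine sideLength_eq hF (-1, -1) (x - 2 * m - 1, y + 3 * m + 1) (-1, 0) m
        ?_ ?_ ?_ ?_ <;>
        simp only [hm] <;> omega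
    | 4 =>
      refine sideLength_eq hF (1, -2) (x - 3 * m - 1, y + m) (1, 0) m
        ?_ ?_ ?_ ?_ <;>
        simp only [hm] <;> omega
    | 5 =>
      refine sideLength_eq hF (2, -1) (x - m, y - 2 * m - 1) (0, -1) m
        ?_ ?_ ?_ ?_ <;>
        simp only [hm] <;> omega
  exact ⟨m + 1, fun i => ⟨hu i, by rw [ht i]⟩⟩

end TriangularLattice

theorem theorem3 (P : TriangularLattice.LamU.Subgraph)
    (hP : P ∈ TriangularLattice.hullPolygons)
    (n : ℕ) (hn : P.verts.ncard = n) (hn3 : 3 ≤ n) :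
    ((¬ ∃ k : ℕ, ∀ i : Fin 6,
        TriangularLattice.u P i = k ∧ TriangularLattice.t P i + 1 = k) →
      (P.edgeSet.ncard : ℤ) ≤ ⌊6 * (n : ℝ) - √(96 * (n : ℝ) - 63)⌋) ∧
    ((∃ k : ℕ, ∀ i : Fin 6,
        TriangularLattice.u P i = k ∧ TriangularLattice.t P i + 1 = k) →
      (P.edgeSet.ncard : ℝ) ≤ 6 * (n : ℝ) - 4 * √(6 * (n : ℝ) - 6)) := by
  have hfin : P.verts.Finite := Set.finite_of_ncard_pos (by omega)
  have hfin' : (TriangularLattice.point ⁻¹' P.verts).Finite :=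
    hfin.preimage TriangularLattice.point_injective.injOn
  have hF : ∀ z, z ∈ hfin'.toFinset ↔ TriangularLattice.point z ∈ P.verts := by simp
  have hcard : hfin'.toFinset.card = n := by
    rw [← Set.ncard_eq_toFinset_card _ hfin', Set.ncard_preimage_of_injective_subset_range
      TriangularLattice.point_injective (by simp [TriangularLattice.point_surjective.range_eq]), hn]
  have hhull : TriangularLattice.HullClosed hfin'.toFinset := by
    obtain ⟨S, -, -, rfl⟩ := hP
    exact TriangularLattice.hullClosed_of_hull hF
  obtain ⟨W, hW, hE, h⟩ := hhull.isoperimetric_bound (by omega)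
  have hedge := TriangularLattice.ncard_edgeSet_le hF
  rw [hcard] at hE h
  have hE' : (P.edgeSet.ncard : ℝ) + W ≤ 6 * n := by
    have : (P.edgeSet.ncard : ℤ) + W ≤ 6 * n := by omega
    exact_mod_cast this
  have hW' : (0 : ℝ) ≤ W := by exact_mod_cast (by omega : 0 ≤ W)
  refine ⟨fun hne => ?_, fun _ => ?_⟩
  · rcases h with h | ⟨-, -, h⟩
    · have h' : 96 * (n : ℝ) - 63 ≤ (W : ℝ) ^ 2 := by exact_mod_cast h
      have := Real.sqrt_le_iff.2 ⟨hW', h'⟩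
      rw [Int.le_floor]
      push_cast
      linarith
    · exact absurd (h.exists_u_t_eq hF) hne
  · have h₁ : 96 * (n : ℤ) - 96 ≤ W ^ 2 := by
      rcases h with h | h
      · linarith
      · exact h.1
    have h₂ : 96 * (n : ℝ) - 96 ≤ (W : ℝ) ^ 2 := by exact_mod_cast h₁
    have := Real.sqrt_le_iff.2 (show (0 : ℝ) ≤ W / 4 ∧ 6 * (n : ℝ) - 6 ≤ (W / 4 : ℝ) ^ 2 from
      ⟨by positivity, by linarith [div_pow (W : ℝ) 4 2]⟩)
    linarith
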